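/- Let $M$ be a matroid on $[n]$, let $\mathcal X\subseteq\{0,1\}^n$ be the set of characteristic vectors of its independent sets, and let $\mathcal Y=\operatorname{conv}\mathcal X$. A weighted threshold potential (WTP) function is a function $$f(x)=\sum_{\ell\in C}c_\ell\min\Big\{b_\ell,\sum_{j\in S_\ell}x_jw_{\ell,j}\Big\},\qquad x\in\{0,1\}^n,$$ given with this representation, where $C$ is an index set (for infinite $C$ the sum is assumed to converge on $\{0,1\}^n$), $c_\ell\in[0,\infty)$, $b_\ell\in[0,\infty]$, $S_\ell\subseteq[n]$, and $w_{\ell,j}\in[0,\infty)$ with $w_{\ell,j}\le b_\ell$ for $j\in S_\ell$. Its degree is $\Delta_f=\max_{\ell}|S_\ell|$, and its concave relaxation $\tilde f$ is given by the same formula at real vectors $y$. Let $\mathcal F$ be a set of WTP functions whose relaxations $\tilde f$, $f\in\mathcal F$, are all $L$-Lipschitz on $\mathcal Y$ for a common $L$. Put $\Delta=\sup_{f\in\mathcal F}\Delta_f$ and $$\alpha=1-\Big(1-\frac1\Delta\Big)^{\Delta}.$$ For a randomized online policy, which chooses $x_t\in\mathcal X$ from $x_1,\dots,x_{t-1}$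 and $f_1,\dots,f_{t-1}$, the $\alpha$-regret at horizon $T$ is $$\sup_{(f_1,\dots,f_T)\in\mathcal F^T}\Big\{\max_{x\in\mathcal X}\ \alpha\sum_{t=1}^Tf_t(x)-\mathbb E\Big[\sum_{t=1}^Tf_t(x_t)\Big]\Big\}.$$ The RAOCO policy runs an online convex optimization (OCO) policy over $\mathcal Y$ on the relaxations, $y_t=\mathcal P_{\mathcal Y,t}\big((y_s)_{s<t},(\tilde f_s)_{s<t}\big)$, and plays $x_t=\Xi(y_t)$ with fresh randomness at each step, where $\Xi:\mathcal Y\to\mathcal X$ is the swap rounding or the randomized pipage rounding of Chekuri, Vondrák and Zenklusen. Both roundings act on points of the base polytope of a matroid; a point of $\mathcal Y$ is first lifted to the base polytope of the matroid obtained from $M$ by adding $\operatorname{rank}(M)$ free dummy elements and truncating to rank $\operatorname{rank}(M)$, and the dummies are dropped from the result. In swap rounding, the point is written as a convex combination $\sum_k\beta_k\mathbf 1_{B_k}$ of bases, which are merged one after the other; merging bases $B,B'$ of weights $\beta,\beta'$ means that, as long as $B\ne B'$, one picks $i\in B\setminus B'$ and $j\in B'\setminus B$ with $B-i+j$ and $B'-j+i$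 both bases, and replaces $B'$ by $B'-j+i$ with probability $\beta/(\beta+\beta')$, and otherwise $B$ by $B-i+j$; the result has weight $\beta+\beta'$. In randomized pipage rounding, as long as the point $z$ is not integral, one picks fractional coordinates $i\neq j$ for which the maximal $\delta_1,\delta_2$ with $z+\delta_1(e_i-e_j)$ and $z-\delta_2(e_i-e_j)$ in the base polytope are both positive, and moves $z$ to the first point with probability $\delta_2/(\delta_1+\delta_2)$ and to the second one otherwise. The OCO policy is one of the following, with learning rate $\eta$ and supergradients $g_t\in\partial\tilde f_t(y_t)$, i.e. $\tilde f_t(y_t)-\tilde f_t(y')\ge g_t\cdot(y_t-y')$ for all $y'\in\mathbb R^n$, chosen as a function of $\tilde f_t$ and $y_t$: * Online gradient ascent (OGA): $y_1\in\mathcal Y$, and $y_{t+1}$ is the Euclidean projection of $y_t+\eta g_t$ onto $\mathcal Y$. * Online mirror ascent (OMA) with a mirror map $\Phi:\mathcal D\to\mathbb R$: $\mathcal D\subseteq\mathbb R^n$ is open and convex, $\mathcal Y\subseteq\overline{\mathcal D}$, $\mathcal Y\cap\mathcal D\ne\emptyset$, $\Phi$ is differentiable and, for some norm and some $\rho>0$,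 $\rho$-strongly convex on $\mathcal D$, $\nabla\Phi:\mathcal D\to\mathbb R^n$ is surjective, and $\|\nabla\Phi\|\to\infty$ at the boundary of $\mathcal D$. With $D_\Phi(y,y')=\Phi(y)-\Phi(y')-\nabla\Phi(y')\cdot(y-y')$, the starting point $y_1\in\mathcal Y\cap\mathcal D$ is such that $D_\Phi(\cdot,y_1)$ is bounded above on $\mathcal Y\cap\mathcal D$, and $y_{t+1}$ minimizes $D_\Phi(\cdot,z_{t+1})$ over $\mathcal Y\cap\mathcal D$, where $\nabla\Phi(z_{t+1})=\nabla\Phi(y_t)+\eta g_t$. * Follow the regularized leader (FTRL) with a regularizer $R:\mathcal Y\to\mathbb R$ that is continuous and $1$-strongly convex with respect to some norm: $y_{t+1}$ minimizes $-\eta\sum_{s\le t}g_s\cdot y+R(y)$ over $\mathcal Y$, for $t\ge0$. Then RAOCO has $\alpha$-regret $O(\sqrt T)$ for learning rates of order $1/\sqrt T$: for all $0<a\le b$ there is a constant $K$, depending only on $M$, $L$, $a$, $b$ and the configuration of the OCO policy ($y_1$ for OGA; $\Phi,\mathcal D,y_1$ for OMA; $R$ for FTRL), such that for every such $\mathcal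 F$, every horizon $T\ge1$, every learning rate $\eta$ with $a/\sqrt T\le\eta\le b/\sqrt T$, every choice of the supergradients, and every such rounding $\Xi$, the $\alpha$-regret at horizon $T$ is at most $K\sqrt T$. -/

import Mathlib

open scoped NNReal ENNReal

universe u

noncomputable section

/-! ## Euclidean space, set systems, matroids as subsets of the cube -/

/-- `ℝⁿ` with its Euclidean structure. -/
abbrev Vec (n : ℕ) : Type := EuclideanSpace ℝ (Fin n)

/-- The characteristic vector of a finite set, as a plain function. -/
def charFun {α : Type*} [DecidableEq α] (A : Finset α) : α → ℝ :=
  fun j => if j ∈ A then 1 else 0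

/-- The characteristic vector of `A ⊆ [n]`, as a point of `{0,1}ⁿ ⊆ ℝⁿ`. -/
def charVec {n : ℕ} (A : Finset (Fin n)) : Vec n := WithLp.toLp 2 (charFun A)

/-- The decision set `𝒳`: the independent sets of the matroid, i.e. (through `charVec`) the matroid
seen as a subset of `{0,1}ⁿ`. -/
abbrev IndepSets {n : ℕ} (M : Matroid (Fin n)) : Type :=
  {A : Finset (Fin n) // M.Indep (A : Set (Fin n))}

instance IndepSets.fintype {n : ℕ} (M : Matroid (Fin n)) : Fintype (IndepSets M) :=
  Fintype.ofFinite _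

/-- `𝒴 = conv 𝒳`. -/
def fracSet {n : ℕ} (M : Matroid (Fin n)) : Set (Vec n) :=
  convexHull ℝ {v | ∃ A : IndepSets M, v = charVec A.1}

/-- The rank of a matroid on `[n]`. -/
def matroidRank {n : ℕ} (M : Matroid (Fin n)) : ℕ := M.eRank.toNat

/-! ## Weighted threshold potentials -/

/-- The threshold potential `Ψ_{b,w,S}(y) = min {b, ∑_{j ∈ S} y_j w_j}`, `b ∈ [0, ∞]`, given by the
same formula at all real points. -/
def thresholdPotential {n : ℕ} (b : ℝ≥0∞) (w : Fin n → ℝ≥0) (S : Finset (Fin n)) (y : Vec n) : ℝ :=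
  if b = ⊤ then ∑ j ∈ S, y j * w j else min b.toReal (∑ j ∈ S, y j * w j)

/-- A weighted threshold potential, with its representation `∑_ℓ c_ℓ Ψ_{b_ℓ,w_ℓ,S_ℓ}` over an
arbitrary index set. Only the values of `w ℓ` on `S ℓ` matter. For an infinite index set the sum is
required to converge at every point of `{0,1}ⁿ`. -/
structure WTP (n : ℕ) : Type (u + 1) where
  /-- the index set -/
  C : Type u
  /-- the coefficients -/
  c : C → ℝ≥0
  /-- the thresholds -/
  b : C → ℝ≥0∞
  /-- the supports -/
  S : C → Finset (Fin n)
  /-- the weights -/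
  w : C → Fin n → ℝ≥0
  w_le : ∀ ℓ, ∀ j ∈ S ℓ, (w ℓ j : ℝ≥0∞) ≤ b ℓ
  summable : ∀ A : Finset (Fin n),
    Summable fun ℓ => (c ℓ : ℝ) * thresholdPotential (b ℓ) (w ℓ) (S ℓ) (charVec A)

/-- The concave relaxation `f̃`: the same functional form, at fractional points. -/
def WTP.relax {n : ℕ} (f : WTP.{u} n) (y : Vec n) : ℝ :=
  ∑' ℓ, (f.c ℓ : ℝ) * thresholdPotential (f.b ℓ) (f.w ℓ) (f.S ℓ) y

/-- The value of the set function `f` at `A ⊆ [n]`. -/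
def WTP.eval {n : ℕ} (f : WTP.{u} n) (A : Finset (Fin n)) : ℝ := f.relax (charVec A)

/-- The degree `Δ_f = max_ℓ |S_ℓ|`. -/
def WTP.degree {n : ℕ} (f : WTP.{u} n) : ℕ := ⨆ ℓ, (f.S ℓ).card

/-- `Δ = sup_{f ∈ 𝓕} Δ_f` (it is at most `n`). -/
def maxDegree {n : ℕ} (𝓕 : Set (WTP.{u} n)) : ℕ := sSup (WTP.degree '' 𝓕)

/-- The approximation ratio `α = 1 - (1 - 1/Δ)^Δ`. -/
def wtpRatio {n : ℕ} (𝓕 : Set (WTP.{u} n)) : ℝ :=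
  1 - (1 - 1 / (maxDegree 𝓕 : ℝ)) ^ maxDegree 𝓕

/-! ## Online learning and `α`-regret -/

/-- A randomized online policy: at (zero-based) time `t` it draws the next decision from a law that
depends on the previous decisions and on the previously revealed reward functions. -/
def OnlinePolicy (X F : Type*) : Type _ := ∀ t : ℕ, (Fin t → X) → (Fin t → F) → PMF X

/-- The law of the first `T` decisions of the policy against the rewards `f₁, …, f_T`. -/
def OnlinePolicy.law {X F : Type*} (P : OnlinePolicy X F) : ∀ T : ℕ, (Fin T → F) → PMF (Fin T → X)
  | 0, _ => PMF.pure Fin.elim0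
  | T + 1, f => (P.law T (Fin.init f)).bind fun xs =>
      (P T xs (Fin.init f)).map fun x => (Fin.snoc xs x : Fin (T + 1) → X)

/-- The expected total reward `𝔼[∑_t f_t(x_t)]`. -/
def OnlinePolicy.expectedReward {X F : Type*} [Fintype X] (P : OnlinePolicy X F) (val : F → X → ℝ)
    (T : ℕ) (f : Fin T → F) : ℝ :=
  ∑ xs : Fin T → X, (P.law T f xs).toReal * ∑ t, val (f t) (xs t)

/-- The `α`-regret at horizon `T`: the supremum, over all sequences of `T` rewards from `𝓕`, of
`max_x α ∑_t f_t(x) - 𝔼[∑_t f_t(x_t)]`. The inner `⨆` is a maximum over the finite (nonempty)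
decision set. -/
def OnlinePolicy.alphaRegret {X F : Type*} [Fintype X] (P : OnlinePolicy X F) (val : F → X → ℝ)
    (α : ℝ) (𝓕 : Set F) (T : ℕ) : EReal :=
  ⨆ (f : Fin T → F) (_ : ∀ t, f t ∈ 𝓕),
    (((⨆ x : X, α * ∑ t, val (f t) x) - P.expectedReward val T f : ℝ) : EReal)

/-! ## OCO policies and the RAOCO policy -/

/-- A (deterministic) OCO policy: the next point is a function of the previous points and of the
previously revealed reward functions. -/
def OCOPolicy (n : ℕ) : Type :=
  ∀ t : ℕ, (Fin t → Vec n) → (Fin t → (Vec n → ℝ)) → Vec n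

/-- The first `t` points played by an OCO policy against given rewards. -/
def OCOPolicy.points {n : ℕ} (P : OCOPolicy n) : ∀ t : ℕ, (Fin t → (Vec n → ℝ)) → Fin t → Vec n
  | 0, _ => Fin.elim0
  | t + 1, g =>
      (Fin.snoc (P.points t (Fin.init g)) (P t (P.points t (Fin.init g)) (Fin.init g)) :
        Fin (t + 1) → Vec n)

/-- The RAOCO policy: run the OCO policy `P` on the concave relaxations of the revealed rewards to
get the fractional point `y_t`, and play `Ξ(y_t)` (with fresh randomness at each step). -/
def raoco {n : ℕ} (M : Matroid (Fin n)) (P : OCOPolicy n) (Ξ : Vec n → PMF (IndepSets M)) :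
    OnlinePolicy (IndepSets M) (WTP.{u} n) :=
  fun t _ fs =>
    let g : Fin t → (Vec n → ℝ) := fun s => (fs s).relax
    Ξ (P t (P.points t g) g)

/-! ## OGA, OMA and FTRL -/

/-- `g` is a supergradient of `f` at `y`. -/
def IsSupergradient {n : ℕ} (f : Vec n → ℝ) (y g : Vec n) : Prop :=
  ∀ y' : Vec n, inner ℝ g (y - y') ≤ f y - f y'

/-- `G` picks a supergradient of each function of `𝓖` at each point of `Y`. -/
def IsSupergradientOracle {n : ℕ} (𝓖 : Set (Vec n → ℝ)) (Y : Set (Vec n))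
    (G : (Vec n → ℝ) → Vec n → Vec n) : Prop :=
  ∀ f ∈ 𝓖, ∀ y ∈ Y, IsSupergradient f y (G f y)

/-- `f` is `ρ`-strongly convex on `s` with respect to the norm (or seminorm) `N`. -/
def StronglyConvexOnWrt {n : ℕ} (N : Seminorm ℝ (Vec n)) (s : Set (Vec n)) (ρ : ℝ)
    (f : Vec n → ℝ) : Prop :=
  Convex ℝ s ∧ ∀ x ∈ s, ∀ y ∈ s, ∀ a b : ℝ, 0 ≤ a → 0 ≤ b → a + b = 1 →
    f (a • x + b • y) ≤ a * f x + b * f y - a * b * (ρ / 2 * N (x - y) ^ 2)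

/-- `Φ : D → ℝ` is a mirror map for the decision set `Y`. -/
structure IsMirrorMap {n : ℕ} (Φ : Vec n → ℝ) (D Y : Set (Vec n)) : Prop where
  isOpen : IsOpen D
  convex : Convex ℝ D
  subset_closure : Y ⊆ closure D
  inter_nonempty : (Y ∩ D).Nonempty
  stronglyConvex : ∃ (N : Seminorm ℝ (Vec n)) (ρ : ℝ), (∀ v, N v = 0 → v = 0) ∧ 0 < ρ ∧
    StronglyConvexOnWrt N D ρ Φ
  differentiable : DifferentiableOn ℝ Φ D
  surjective : ∀ v : Vec n, ∃ x ∈ D, gradient Φ x = v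
  diverges : ∀ x ∈ closure D \ D,
    Filter.Tendsto (fun z => ‖gradient Φ z‖) (nhdsWithin x D) Filter.atTop

/-- The Bregman divergence `D_Φ(y, y')`. -/
def bregman {n : ℕ} (Φ : Vec n → ℝ) (y y' : Vec n) : ℝ :=
  Φ y - Φ y' - inner ℝ (gradient Φ y') (y - y')

/-- `y` is a Bregman projection of `z` onto `S`. -/
def IsBregmanProj {n : ℕ} (Φ : Vec n → ℝ) (S : Set (Vec n)) (z y : Vec n) : Prop :=
  y ∈ S ∧ ∀ y' ∈ S, bregman Φ y z ≤ bregman Φ y' z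

/-- `R` is an admissible regularizer on `Y`: `1`-strongly convex with respect to some norm, and
continuous. -/
def IsRegularizer {n : ℕ} (R : Vec n → ℝ) (Y : Set (Vec n)) : Prop :=
  (∃ N : Seminorm ℝ (Vec n), (∀ v, N v = 0 → v = 0) ∧ StronglyConvexOnWrt N Y 1 R) ∧
    ContinuousOn R Y

/-- The three OCO methods with their configuration (apart from the learning rate): the starting
point for OGA; the mirror map, its domain and the starting point for OMA; the regularizer for
FTRL. -/
inductive OCOMethod (n : ℕ) : Type
  | oga (y₁ : Vec n)
  | oma (Φ : Vec n → ℝ) (D : Set (Vec n)) (y₁ : Vec n)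
  | ftrl (R : Vec n → ℝ)

/-- The standing assumptions on the configuration of the method, for the decision set `Y`. -/
def OCOMethod.Admissible {n : ℕ} (Y : Set (Vec n)) : OCOMethod n → Prop
  | .oga y₁ => y₁ ∈ Y
  | .oma Φ D y₁ => IsMirrorMap Φ D Y ∧ y₁ ∈ Y ∩ D ∧ ∃ K : ℝ, ∀ y ∈ Y ∩ D, bregman Φ y y₁ ≤ K
  | .ftrl R => IsRegularizer R Y

/-- `P` is the policy that the method, with learning rate `η` and supergradients chosen by `G`,
prescribes over the decision set `Y`, for rewards in `𝓖`.
* OGA: `y_{t+1}` is the Euclidean projection onto `Y` of `y_t + η g_t`.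
* OMA: `∇Φ(z_{t+1}) = ∇Φ(y_t) + η g_t`, and `y_{t+1}` is the Bregman projection of `z_{t+1}` onto
  `Y ∩ D`.
* FTRL: `y_{t+1}` minimizes `-η ∑_{s ≤ t} g_s · y + R(y)` over `Y`. -/
def OCOMethod.IsPolicy {n : ℕ} (Y : Set (Vec n)) (𝓖 : Set (Vec n → ℝ))
    (G : (Vec n → ℝ) → Vec n → Vec n) (η : ℝ) (P : OCOPolicy n) : OCOMethod n → Prop
  | .oga y₁ =>
      (∀ ys gs, P 0 ys gs = y₁) ∧
      ∀ (t : ℕ) (ys : Fin (t + 1) → Vec n) (gs : Fin (t + 1) → (Vec n → ℝ)),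
        (∀ s, ys s ∈ Y) → (∀ s, gs s ∈ 𝓖) →
        let z := ys (Fin.last t) + η • G (gs (Fin.last t)) (ys (Fin.last t))
        P (t + 1) ys gs ∈ Y ∧ ∀ y' ∈ Y, ‖z - P (t + 1) ys gs‖ ≤ ‖z - y'‖
  | .oma Φ D y₁ =>
      (∀ ys gs, P 0 ys gs = y₁) ∧
      ∀ (t : ℕ) (ys : Fin (t + 1) → Vec n) (gs : Fin (t + 1) → (Vec n → ℝ)),
        (∀ s, ys s ∈ Y ∩ D) → (∀ s, gs s ∈ 𝓖) →
        ∃ z ∈ D,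
          gradient Φ z = gradient Φ (ys (Fin.last t))
            + η • G (gs (Fin.last t)) (ys (Fin.last t)) ∧
          IsBregmanProj Φ (Y ∩ D) z (P (t + 1) ys gs)
  | .ftrl R =>
      ∀ (t : ℕ) (ys : Fin t → Vec n) (gs : Fin t → (Vec n → ℝ)),
        (∀ s, ys s ∈ Y) → (∀ s, gs s ∈ 𝓖) →
        P t ys gs ∈ Y ∧
        ∀ y' ∈ Y, -η * ∑ s, inner ℝ (G (gs s) (ys s)) (P t ys gs) + R (P t ys gs)
          ≤ -η * ∑ s, inner ℝ (G (gs s) (ys s)) y' + R y'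

/-! ## Swap rounding and randomized pipage rounding -/

/-- Draw from `p` with probability `a / (a + b)`, and otherwise (with probability `b / (a + b)` if
`a + b ≠ 0`) from `q`. -/
def mixPMF {β : Type*} (a b : ℝ≥0) (p q : PMF β) : PMF β :=
  (PMF.ofFintype
    (fun h : Bool => cond h ((a / (a + b) : ℝ≥0) : ℝ≥0∞) (1 - ((a / (a + b) : ℝ≥0) : ℝ≥0∞)))
    (by
      have h : ((a / (a + b) : ℝ≥0) : ℝ≥0∞) ≤ 1 := by
        exact_mod_cast div_le_one_of_le₀ (le_add_of_nonneg_right (zero_le (a := b)))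
          (zero_le (a := a + b))
      simp [add_tsub_cancel_of_le h])).bind
    fun h => cond h p q

/-- The base polytope of a family of sets (the bases of a matroid). -/
def basePolytope {α : Type*} [DecidableEq α] (𝓑 : Set (Finset α)) : Set (α → ℝ) :=
  convexHull ℝ (charFun '' 𝓑)

/-- `MergeLaw 𝓑 β₁ β₂ B₁ B₂ p`: `p` is the law of the output of a run of the merging procedure of
swap rounding on the bases `B₁`, `B₂` with weights `β₁`, `β₂`. While `B₁ ≠ B₂`, elements
`i ∈ B₁ \ B₂`, `j ∈ B₂ \ B₁` with `B₁ - i + j`, `B₂ - j + i` both bases are chosen; with probability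
`β₁ / (β₁ + β₂)`, `B₂` is replaced by `B₂ - j + i`, and otherwise `B₁` by `B₁ - i + j`. -/
inductive MergeLaw {α : Type*} [DecidableEq α] (𝓑 : Set (Finset α)) (β₁ β₂ : ℝ≥0) :
    Finset α → Finset α → PMF (Finset α) → Prop
  | done (B : Finset α) : MergeLaw 𝓑 β₁ β₂ B B (PMF.pure B)
  | step {B₁ B₂ : Finset α} {i j : α} {p q : PMF (Finset α)}
      (hi : i ∈ B₁ \ B₂) (hj : j ∈ B₂ \ B₁)
      (h₁ : insert j (B₁.erase i) ∈ 𝓑) (h₂ : insert i (B₂.erase j) ∈ 𝓑)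
      (hp : MergeLaw 𝓑 β₁ β₂ B₁ (insert i (B₂.erase j)) p)
      (hq : MergeLaw 𝓑 β₁ β₂ (insert j (B₁.erase i)) B₂ q) :
      MergeLaw 𝓑 β₁ β₂ B₁ B₂ (mixPMF β₁ β₂ p q)

/-- `SwapChainLaw 𝓑 β B l p`: `p` is the law of the output of swap rounding when the bases merged
so far, of total weight `β`, have given `B`, and `l` lists the weighted bases still to be
merged. -/
inductive SwapChainLaw {α : Type*} [DecidableEq α] (𝓑 : Set (Finset α)) :
    ℝ≥0 → Finset α → List (ℝ≥0 × Finset α) → PMF (Finset α) → Prop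
  | nil (β : ℝ≥0) (B : Finset α) : SwapChainLaw 𝓑 β B [] (PMF.pure B)
  | cons {β β' : ℝ≥0} {B B' : Finset α} {l : List (ℝ≥0 × Finset α)} {p : PMF (Finset α)}
      {q : Finset α → PMF (Finset α)}
      (hp : MergeLaw 𝓑 β β' B B' p)
      (hq : ∀ A ∈ p.support, SwapChainLaw 𝓑 (β + β') A l (q A)) :
      SwapChainLaw 𝓑 β B ((β', B') :: l) (p.bind q)

/-- `p` is the law of the output of swap rounding at the point `z` of the base polytope: `z` is
written as a convex combination of bases (with positive weights), which are merged one after the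
other. -/
def IsSwapLaw {α : Type*} [DecidableEq α] (𝓑 : Set (Finset α)) (z : α → ℝ)
    (p : PMF (Finset α)) : Prop :=
  ∃ (β : ℝ≥0) (B : Finset α) (l : List (ℝ≥0 × Finset α)),
    (∀ c ∈ (β, B) :: l, 0 < c.1 ∧ c.2 ∈ 𝓑) ∧
    (((β, B) :: l).map Prod.fst).sum = 1 ∧
    (((β, B) :: l).map fun c => (c.1 : ℝ) • charFun c.2).sum = z ∧
    SwapChainLaw 𝓑 β B l p

/-- `IsPipageLaw 𝓑 z p`: `p` is the law of the output of a run of randomized pipage rounding at the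
point `z` of the base polytope. While `z` is not integral, two fractional coordinates `i ≠ j` are
chosen such that `z` can be moved inside the polytope in both directions `±(e_i - e_j)`; the maximal
moves `δ₁`, `δ₂` in these two directions are determined, and `z` is replaced by
`z + δ₁ (e_i - e_j)` with probability `δ₂ / (δ₁ + δ₂)` and by `z - δ₂ (e_i - e_j)` otherwise. -/
inductive IsPipageLaw {α : Type*} [DecidableEq α] (𝓑 : Set (Finset α)) :
    (α → ℝ) → PMF (Finset α) → Prop
  | done {B : Finset α} (hB : B ∈ 𝓑) : IsPipageLaw 𝓑 (charFun B) (PMF.pure B)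
  | step {z : α → ℝ} {i j : α} {δ₁ δ₂ : ℝ≥0} {p q : PMF (Finset α)}
      (hij : i ≠ j) (hi : z i ∈ Set.Ioo (0 : ℝ) 1) (hj : z j ∈ Set.Ioo (0 : ℝ) 1)
      (hδ₁ : 0 < δ₁) (hδ₂ : 0 < δ₂)
      (h₁ : IsGreatest {δ : ℝ | z + δ • (Pi.single i 1 - Pi.single j 1) ∈ basePolytope 𝓑} δ₁)
      (h₂ : IsGreatest {δ : ℝ | z - δ • (Pi.single i 1 - Pi.single j 1) ∈ basePolytope 𝓑} δ₂)
      (hp : IsPipageLaw 𝓑 (z + (δ₁ : ℝ) • (Pi.single i 1 - Pi.single j 1)) p)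
      (hq : IsPipageLaw 𝓑 (z - (δ₂ : ℝ) • (Pi.single i 1 - Pi.single j 1)) q) :
      IsPipageLaw 𝓑 z (mixPMF δ₂ δ₁ p q)

/-- The bases of the matroid obtained from `M` by adding `r = rank M` dummy (free) elements and
truncating to rank `r`: the `r`-element sets whose non-dummy part is independent in `M`. Independent
sets of `M` are the traces of these bases, and `conv 𝒳` is the projection of their base polytope;
both roundings, which act on base polytopes, are applied to points of `conv 𝒳` in this way. -/
def paddedBases {n : ℕ} (M : Matroid (Fin n)) : Set (Finset (Fin n ⊕ Fin (matroidRank M))) :=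
  {B | B.card = matroidRank M ∧ M.Indep (B.toLeft : Set (Fin n))}

/-- `Ξ` is swap rounding on `conv 𝒳` (for some choice of the padded point, of the decomposition
into bases, and of the exchanged elements). -/
def IsSwapRounding {n : ℕ} (M : Matroid (Fin n)) (Ξ : Vec n → PMF (IndepSets M)) : Prop :=
  ∀ y ∈ fracSet M, ∃ (z : Fin n ⊕ Fin (matroidRank M) → ℝ)
    (p : PMF (Finset (Fin n ⊕ Fin (matroidRank M)))),
    z ∈ basePolytope (paddedBases M) ∧ (∀ j, z (Sum.inl j) = y j) ∧
    IsSwapLaw (paddedBases M) z p ∧ (Ξ y).map Subtype.val = p.map Finset.toLeft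

/-- `Ξ` is randomized pipage rounding on `conv 𝒳` (for some choice of the padded point and of the
pairs of coordinates). -/
def IsPipageRounding {n : ℕ} (M : Matroid (Fin n)) (Ξ : Vec n → PMF (IndepSets M)) : Prop :=
  ∀ y ∈ fracSet M, ∃ (z : Fin n ⊕ Fin (matroidRank M) → ℝ)
    (p : PMF (Finset (Fin n ⊕ Fin (matroidRank M)))),
    z ∈ basePolytope (paddedBases M) ∧ (∀ j, z (Sum.inl j) = y j) ∧
    IsPipageLaw (paddedBases M) z p ∧ (Ξ y).map Subtype.val = p.map Finset.toLeft

end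

/-! Two estimates combine: rounding loses at most the factor `α` in expectation, and the OCO policy
has regret `O(√T)` on the concave relaxations. Since `f̃` agrees with `f` at integral points, `α ∑
f_t(x) - 𝔼 ∑ f_t(x_t) ≤ α ∑ (f̃_t(x) - f̃_t(y_t))`, and `0 ≤ α ≤ 1`.

Rounding (`wtpRatio_mul_relax_le`): each random move of either procedure is a mean-preserving step
along some `e_i - e_j`, so a potential concave along these directions does not increase in
expectation. The product `∏ (1 - v_j z_j)` is such a potential (`exchangeConcave_prod`). For `v_j =
w_j / b` and `σ = ∑ v_j y_j` this gives `𝔼 min(1, ∑ v_j x_j) ≥ 1 - 𝔼 ∏ (1 - v_j x_j) ≥ 1 - ∏ (1 -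
v_j y_j) ≥ 1 - (1 - σ/Δ)^Δ ≥ α min(1, σ)`, by the union bound, the potential, AM-GM and convexity of
`x ^ Δ`. Summation over `ℓ` gives the claim for `f`.

Regret (`OCOMethod.regret`): concavity reduces regret to `∑ g_t · (u - y_t)`. Supergradients on all
of `ℝⁿ` are uniformly bounded along differences of points of the polytope
(`IsSupergradient.inner_sub_le`), and strong convexity absorbs the cost of moving from `y_t` to
`y_{t+1}`. For OGA and OMA a divergence to the comparator telescopes (`sum_inner_le_of_step`); for
FTRL the minimum of the regularized objective is tracked. In all cases `η` times the sum is at most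
`K + T η² K`, and `η` of order `1/√T` balances the two terms. -/

/-! ## Expectations under laws on finite types -/

/-- The expectation of `h` under the law `p` on a finite type. -/
noncomputable def PMF.expect {β : Type*} [Fintype β] (p : PMF β) (h : β → ℝ) : ℝ :=
  ∑ a, (p a).toReal * h a

namespace PMF

variable {β γ : Type*} [Fintype β] [Fintype γ]

theorem sum_toReal (p : PMF β) : ∑ a, (p a).toReal = 1 := by
  rw [← ENNReal.toReal_sum fun a _ => p.apply_ne_top a, ← tsum_fintype (L := .unconditional _),
    p.tsum_coe, ENNReal.toReal_one]

theorem expect_const (p : PMF β) (c : ℝ) : p.expect (fun _ => c) = c := by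
  rw [expect, ← Finset.sum_mul, sum_toReal, one_mul]

theorem expect_add (p : PMF β) (h k : β → ℝ) :
    p.expect (fun a => h a + k a) = p.expect h + p.expect k := by
  simp only [expect, mul_add, Finset.sum_add_distrib]

theorem expect_const_mul (p : PMF β) (c : ℝ) (h : β → ℝ) :
    p.expect (fun a => c * h a) = c * p.expect h := by
  simp only [expect, Finset.mul_sum]
  exact Finset.sum_congr rfl fun a _ => by ring

theorem expect_mono_support (p : PMF β) {h k : β → ℝ} (H : ∀ a ∈ p.support, h a ≤ k a) :
    p.expect h ≤ p.expect k := by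
  refine Finset.sum_le_sum fun a _ => ?_
  by_cases ha : p a = 0
  · simp [ha]
  · exact mul_le_mul_of_nonneg_left (H a ((p.mem_support_iff a).2 ha)) ENNReal.toReal_nonneg

theorem expect_mono (p : PMF β) {h k : β → ℝ} (H : ∀ a, h a ≤ k a) : p.expect h ≤ p.expect k :=
  p.expect_mono_support fun a _ => H a

theorem expect_pure (b : β) (h : β → ℝ) : (PMF.pure b).expect h = h b := by
  classical
  rw [expect, Finset.sum_eq_single b]
  · simp
  · intro a _ hab
    simp [hab]
  · simp

theorem expect_bind (p : PMF β) (q : β → PMF γ) (h : γ → ℝ) :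
    (p.bind q).expect h = p.expect fun a => (q a).expect h := by
  have key : ∀ c, ((p.bind q) c).toReal = ∑ a, (p a).toReal * (q a c).toReal := by
    intro c
    rw [PMF.bind_apply, tsum_fintype, ENNReal.toReal_sum]
    · simp only [ENNReal.toReal_mul]
    · exact fun a _ => ENNReal.mul_ne_top (p.apply_ne_top a) ((q a).apply_ne_top c)
  simp only [expect, key, Finset.sum_mul, Finset.mul_sum]
  rw [Finset.sum_comm]
  exact Finset.sum_congr rfl fun a _ => Finset.sum_congr rfl fun c _ => by ring

theorem expect_map (p : PMF β) (φ : β → γ) (h : γ → ℝ) :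
    (p.map φ).expect h = p.expect (h ∘ φ) := by
  rw [← PMF.bind_pure_comp, expect_bind]
  simp only [Function.comp_apply, expect_pure]
  rfl

theorem expect_mixPMF {a b : ℝ≥0} (hab : 0 < a + b) (p q : PMF β) (h : β → ℝ) :
    ((a : ℝ) + b) * (mixPMF a b p q).expect h = a * p.expect h + b * q.expect h := by
  have hab' : (0 : ℝ) < a + b := by exact_mod_cast hab
  have hle : ((a / (a + b) : ℝ≥0) : ℝ≥0∞) ≤ 1 := by
    exact_mod_cast div_le_one_of_le₀ (le_add_of_nonneg_right (zero_le (a := b)))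
      (zero_le (a := a + b))
  rw [mixPMF, expect_bind, expect]
  simp only [Fintype.sum_bool, PMF.ofFintype_apply, cond_true, cond_false,
    ENNReal.toReal_sub_of_le hle ENNReal.one_ne_top, ENNReal.coe_toReal, ENNReal.toReal_one,
    NNReal.coe_div, NNReal.coe_add]
  field_simp
  ring

end PMF

/-! ## Potentials that are concave along exchange directions, and the two roundings -/

/-- `Q` is concave on the cube along the exchange directions `e_i - e_j`. -/
def ExchangeConcave {α : Type*} [DecidableEq α] (Q : (α → ℝ) → ℝ) : Prop :=
  ∀ (z : α → ℝ) (i j : α) (s t : ℝ), i ≠ j → 0 ≤ s → 0 ≤ t →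
    z + s • (Pi.single i 1 - Pi.single j 1) ∈ Set.Icc (0 : α → ℝ) 1 →
    z - t • (Pi.single i 1 - Pi.single j 1) ∈ Set.Icc (0 : α → ℝ) 1 →
    t * Q (z + s • (Pi.single i 1 - Pi.single j 1)) +
      s * Q (z - t • (Pi.single i 1 - Pi.single j 1)) ≤ (t + s) * Q z

section Rounding

variable {α : Type*} [DecidableEq α]

theorem charFun_nonneg (A : Finset α) : 0 ≤ charFun A := fun j => by
  simp only [charFun, Pi.zero_apply]; split_ifs <;> norm_num

theorem charFun_le_one (A : Finset α) : charFun A ≤ 1 := fun j => by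
  simp only [charFun, Pi.one_apply]; split_ifs <;> norm_num

theorem charFun_insert_erase {B : Finset α} {i j : α} (hj : j ∈ B) (hi : i ∉ B) :
    charFun (insert i (B.erase j)) = charFun B + (Pi.single i 1 - Pi.single j 1) := by
  have hij : i ≠ j := fun h => hi (h ▸ hj)
  funext k
  simp only [charFun, Finset.mem_insert, Finset.mem_erase, Pi.add_apply, Pi.sub_apply,
    Pi.single_apply]
  rcases eq_or_ne k i with rfl | hk
  · simp [hij, hi]
  · rcases eq_or_ne k j with rfl | hk'
    · simp [hk, hj]
    · simp [hk, hk']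

theorem basePolytope_subset_cube (𝓑 : Set (Finset α)) :
    basePolytope 𝓑 ⊆ Set.Icc (0 : α → ℝ) 1 := by
  refine convexHull_min ?_ (convex_Icc _ _)
  rintro _ ⟨B, _, rfl⟩
  exact ⟨charFun_nonneg B, charFun_le_one B⟩

variable [Fintype α]

/-- Each move has mean zero: a step of length `δ₁` one way has probability proportional to `δ₂`, and
conversely. Concavity along the move then gives a supermartingale. -/
theorem IsPipageLaw.expect_le {𝓑 : Set (Finset α)} {Q : (α → ℝ) → ℝ} (hQ : ExchangeConcave Q)
    {z : α → ℝ} {p : PMF (Finset α)} (h : IsPipageLaw 𝓑 z p) :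
    p.expect (fun A => Q (charFun A)) ≤ Q z := by
  induction h with
  | done hB => rw [PMF.expect_pure]
  | @step z i j δ₁ δ₂ p q hij hi hj hδ₁ hδ₂ h₁ h₂ hp hq ihp ihq =>
    have key := hQ z i j δ₁ δ₂ hij δ₁.2 δ₂.2 (basePolytope_subset_cube 𝓑 h₁.1)
      (basePolytope_subset_cube 𝓑 h₂.1)
    have hpos : (0 : ℝ) < (δ₂ : ℝ) + δ₁ := by exact_mod_cast add_pos hδ₂ hδ₁
    have hmix := PMF.expect_mixPMF (add_pos hδ₂ hδ₁) p q fun A => Q (charFun A)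
    have h3 := mul_le_mul_of_nonneg_left ihp δ₂.2
    have h4 := mul_le_mul_of_nonneg_left ihq δ₁.2
    refine le_of_mul_le_mul_left ?_ hpos
    rw [hmix]
    exact (add_le_add h3 h4).trans key

/-- The vector `r` stands for the bases still waiting to be merged, so `Q` is evaluated at the
current point of the whole rounding. The bound on `r` keeps that point in the cube, where alone `Q`
is known to be concave. -/
theorem MergeLaw.expect_le {𝓑 : Set (Finset α)} {Q : (α → ℝ) → ℝ} (hQ : ExchangeConcave Q)
    {β₁ β₂ : ℝ≥0} (hβ : 0 < β₁ + β₂) {r : α → ℝ} (hr : 0 ≤ r)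
    (hr' : ∀ j, r j ≤ 1 - (β₁ + β₂ : ℝ)) {B₁ B₂ : Finset α} {p : PMF (Finset α)}
    (h : MergeLaw 𝓑 β₁ β₂ B₁ B₂ p) :
    p.expect (fun A => Q (((β₁ : ℝ) + β₂) • charFun A + r)) ≤
      Q ((β₁ : ℝ) • charFun B₁ + (β₂ : ℝ) • charFun B₂ + r) := by
  have cube : ∀ A B : Finset α,
      (β₁ : ℝ) • charFun A + (β₂ : ℝ) • charFun B + r ∈ Set.Icc (0 : α → ℝ) 1 := by
    intro A B
    refine ⟨add_nonneg (add_nonneg (smul_nonneg β₁.2 (charFun_nonneg A))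
      (smul_nonneg β₂.2 (charFun_nonneg B))) hr, fun j => ?_⟩
    have h1 := mul_le_mul_of_nonneg_left (charFun_le_one A j) β₁.2
    have h2 := mul_le_mul_of_nonneg_left (charFun_le_one B j) β₂.2
    have h3 := hr' j
    simp only [Pi.add_apply, Pi.smul_apply, smul_eq_mul, Pi.one_apply, NNReal.val_eq_coe] at *
    linarith
  induction h with
  | done B => rw [PMF.expect_pure, add_smul]
  | @step B₁ B₂ i j p q hi hj h₁ h₂ hp hq ihp ihq =>
    rw [Finset.mem_sdiff] at hi hj
    have hij : i ≠ j := fun h => hi.2 (h ▸ hj.1)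
    set z := (β₁ : ℝ) • charFun B₁ + (β₂ : ℝ) • charFun B₂ + r with hz
    have e1 : (β₁ : ℝ) • charFun B₁ + (β₂ : ℝ) • charFun (insert i (B₂.erase j)) + r
        = z + (β₂ : ℝ) • (Pi.single i 1 - Pi.single j 1) := by
      rw [charFun_insert_erase hj.1 hi.2, hz, smul_add]; abel
    have e2 : (β₁ : ℝ) • charFun (insert j (B₁.erase i)) + (β₂ : ℝ) • charFun B₂ + r
        = z - (β₁ : ℝ) • (Pi.single i 1 - Pi.single j 1) := by
      rw [charFun_insert_erase hi.1 hj.2, hz, smul_add, smul_sub, smul_sub]; abel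
    -- The weights cross: changing `B₂` moves the point by `β₂` and has probability proportional to
    -- `β₁`.
    have key := hQ z i j β₂ β₁ hij β₂.2 β₁.2 (e1 ▸ cube _ _) (e2 ▸ cube _ _)
    rw [e1] at ihp
    rw [e2] at ihq
    have hpos : (0 : ℝ) < (β₁ : ℝ) + β₂ := by exact_mod_cast hβ
    have hmix := PMF.expect_mixPMF hβ p q fun A => Q (((β₁ : ℝ) + β₂) • charFun A + r)
    have h3 := mul_le_mul_of_nonneg_left ihp β₁.2
    have h4 := mul_le_mul_of_nonneg_left ihq β₂.2
    refine le_of_mul_le_mul_left ?_ hpos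
    rw [hmix]
    exact (add_le_add h3 h4).trans key

theorem SwapChainLaw.expect_le {𝓑 : Set (Finset α)} {Q : (α → ℝ) → ℝ} (hQ : ExchangeConcave Q)
    {β : ℝ≥0} {B : Finset α} {l : List (ℝ≥0 × Finset α)} {p : PMF (Finset α)}
    (h : SwapChainLaw 𝓑 β B l p) (hβ : 0 < β) (hsum : β + (l.map Prod.fst).sum = 1) :
    p.expect (fun A => Q (charFun A)) ≤
      Q ((β : ℝ) • charFun B + (l.map fun c => (c.1 : ℝ) • charFun c.2).sum) := by
  -- The unmerged part has coordinates at most its total weight, which is what `MergeLaw.expect_le`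
  -- asks of `r`.
  have tail : ∀ l : List (ℝ≥0 × Finset α),
      0 ≤ (l.map fun c => (c.1 : ℝ) • charFun c.2).sum ∧
      ∀ j, (l.map fun c => (c.1 : ℝ) • charFun c.2).sum j ≤ ((l.map Prod.fst).sum : ℝ≥0) := by
    intro l
    induction l with
    | nil => simp
    | cons c l ih =>
      simp only [List.map_cons, List.sum_cons, NNReal.coe_add]
      refine ⟨add_nonneg (smul_nonneg c.1.2 (charFun_nonneg _)) ih.1, fun j => ?_⟩
      refine add_le_add ?_ (ih.2 j)
      exact mul_le_of_le_one_right c.1.2 (charFun_le_one c.2 j)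
  induction h with
  | nil β B =>
    have : β = 1 := by simpa using hsum
    simp [PMF.expect_pure, this]
  | @cons β β' B B' l p q hp hq ih =>
    simp only [List.map_cons, List.sum_cons] at hsum ⊢
    rw [← add_assoc] at hsum
    have hpos : 0 < β + β' := add_pos_of_pos_of_nonneg hβ (zero_le (a := β'))
    set r := (l.map fun c => (c.1 : ℝ) • charFun c.2).sum with hr
    have hr' : ∀ j, r j ≤ 1 - (β + β' : ℝ) := fun j => by
      have h1 := (tail l).2 j
      have h2 : ((β + β' + (l.map Prod.fst).sum : ℝ≥0) : ℝ) = 1 := by rw [hsum]; rfl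
      rw [NNReal.coe_add, NNReal.coe_add] at h2
      linarith
    rw [PMF.expect_bind, ← add_assoc]
    refine le_trans (p.expect_mono_support fun A hA => ?_)
      (hp.expect_le hQ hpos (tail l).1 hr')
    simpa using ih A hA hpos hsum

theorem IsSwapLaw.expect_le {𝓑 : Set (Finset α)} {Q : (α → ℝ) → ℝ} (hQ : ExchangeConcave Q)
    {z : α → ℝ} {p : PMF (Finset α)} (h : IsSwapLaw 𝓑 z p) :
    p.expect (fun A => Q (charFun A)) ≤ Q z := by
  obtain ⟨β, B, l, hpos, hsum, rfl, hl⟩ := h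
  simpa using hl.expect_le hQ (hpos _ List.mem_cons_self).1 (by simpa using hsum)

end Rounding

/-! ## Concrete potentials -/

section Potentials

variable {α : Type*} [DecidableEq α]

theorem exchangeConcave_linear {ι : Type*} (S : Finset ι) (e : ι → α) (w : ι → ℝ) :
    ExchangeConcave fun z : α → ℝ => ∑ j ∈ S, z (e j) * w j := by
  intro z i j s t _ _ _ _ _
  rw [Finset.mul_sum, Finset.mul_sum, Finset.mul_sum, ← Finset.sum_add_distrib]
  refine (Finset.sum_congr rfl fun k _ => ?_).le
  simp only [Pi.add_apply, Pi.sub_apply, Pi.smul_apply, smul_eq_mul]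
  ring

/-- As `e` is injective, at most one factor involves coordinate `i` and at most one involves `j`.
Along `e_i - e_j` the product is thus a nonnegative constant times a decreasing and an increasing
affine function (in the weak sense), a quadratic with nonpositive leading coefficient. -/
theorem exchangeConcave_prod {γ : Type*} [DecidableEq γ] {e : γ → α}
    (S : Finset γ) (he : Function.Injective e) (v : γ → ℝ) (hv : ∀ j ∈ S, v j ∈ Set.Icc (0 : ℝ) 1) :
    ExchangeConcave fun z : α → ℝ => ∏ j ∈ S, (1 - v j * z (e j)) := by
  intro z i j s t hij hs ht h₁ h₂
  set d : α → ℝ := Pi.single i 1 - Pi.single j 1 with hd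
  -- Only the two endpoints are assumed to be in the cube; `z` is a convex combination of them
  -- unless both steps vanish.
  have hz : z ∈ Set.Icc (0 : α → ℝ) 1 ∨ t + s = 0 := by
    rcases (add_nonneg ht hs).lt_or_eq with h | h
    · left
      have : z = (t / (t + s)) • (z + s • d) + (s / (t + s)) • (z - t • d) := by
        funext k
        simp only [Pi.add_apply, Pi.sub_apply, Pi.smul_apply, smul_eq_mul]
        field_simp
        ring
      rw [this]
      exact convex_Icc _ _ h₁ h₂ (by positivity) (by positivity) (by field_simp)
    · exact Or.inr h.symm
  rcases hz with hz | hz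
  swap
  · have h1 : t = 0 := by linarith
    have h2 : s = 0 := by linarith
    simp [h1, h2]
  have hfac : ∀ k ∈ S, 0 ≤ 1 - v k * z (e k) := fun k hk => by
    have := mul_le_one₀ (hv k hk).2 (hz.1 (e k)) (hz.2 (e k))
    linarith
  have hd0 : ∀ k, k ≠ i → k ≠ j → d k = 0 := fun k h1 h2 => by simp [hd, h1, h2]
  have hdi : d i = 1 := by simp [hd, hij]
  have hdj : d j = -1 := by simp [hd, hij.symm]
  -- the factors indexed by `i` and `j` are split off
  obtain ⟨c, hc, f, g, hfg⟩ : ∃ c : ℝ, 0 ≤ c ∧ ∃ f g : ℝ × ℝ,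
      (0 ≤ f.2 ∧ 0 ≤ g.2) ∧ ∀ u : ℝ,
        ∏ k ∈ S, (1 - v k * (z + u • d) (e k)) = c * ((f.1 - f.2 * u) * (g.1 + g.2 * u)) := by
    -- Extracts the factor that involves coordinate `l`; the pair `(1, 0)` stands for a missing
    -- factor.
    have split : ∀ (S : Finset γ) (l : α) (σ : ℝ), (∀ k ∈ S, v k ∈ Set.Icc (0 : ℝ) 1) →
        d l = σ → ∃ S' ⊆ S, (∀ k ∈ S', e k ≠ l) ∧ ∃ f : ℝ × ℝ, 0 ≤ f.2 ∧ ∀ u : ℝ,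
          ∏ k ∈ S, (1 - v k * (z + u • d) (e k)) =
            (∏ k ∈ S', (1 - v k * (z + u • d) (e k))) * (f.1 - f.2 * σ * u) := by
      intro S l σ hS hl
      by_cases hex : ∃ k ∈ S, e k = l
      · obtain ⟨k, hk, rfl⟩ := hex
        refine ⟨S.erase k, Finset.erase_subset _ _, fun m hm h => ?_,
          (1 - v k * z (e k), v k), (hS k hk).1, fun u => ?_⟩
        · exact (Finset.mem_erase.1 hm).1 (he h)
        · rw [← Finset.prod_erase_mul _ _ hk]
          simp only [Pi.add_apply, Pi.smul_apply, smul_eq_mul, hl]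
          ring
      · push Not at hex
        exact ⟨S, subset_rfl, hex, (1, 0), le_rfl, fun u => by simp⟩
    obtain ⟨S₁, hS₁, hi₁, f, hf, hfu⟩ := split S i 1 hv hdi
    obtain ⟨S₂, hS₂, hj₂, g, hg, hgu⟩ := split S₁ j (-1) (fun k hk => hv k (hS₁ hk)) hdj
    refine ⟨∏ k ∈ S₂, (1 - v k * z (e k)),
      Finset.prod_nonneg fun k hk => hfac k (hS₁ (hS₂ hk)), f, g, ⟨hf, hg⟩, fun u => ?_⟩
    have : ∏ k ∈ S₂, (1 - v k * (z + u • d) (e k)) = ∏ k ∈ S₂, (1 - v k * z (e k)) :=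
      Finset.prod_congr rfl fun k hk => by
        simp [hd0 _ (hi₁ k (hS₂ hk)) (hj₂ k hk)]
    rw [hfu, hgu, this]
    ring
  have e0 : ∏ k ∈ S, (1 - v k * z (e k)) = c * (f.1 * g.1) := by
    have := hfg.2 0
    simpa using this
  have e2 : z - t • d = z + (-t) • d := by rw [neg_smul, sub_eq_add_neg]
  simp only [e2, e0, hfg.2]
  -- This is exactly the gap between the two sides.
  have : 0 ≤ c * (f.2 * g.2) * (t * s * (t + s)) :=
    mul_nonneg (mul_nonneg hc (mul_nonneg hfg.1.1 hfg.1.2))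
      (mul_nonneg (mul_nonneg ht hs) (add_nonneg ht hs))
  nlinarith [this]

end Potentials

/-! ## Threshold potentials and their sums -/

section Threshold

variable {n : ℕ}

@[simp] theorem charVec_apply (A : Finset (Fin n)) (j : Fin n) :
    charVec A j = if j ∈ A then 1 else 0 := rfl

theorem charVec_empty : charVec (∅ : Finset (Fin n)) = 0 := by
  ext j; simp

theorem thresholdPotential_mono (b : ℝ≥0∞) (w : Fin n → ℝ≥0) (S : Finset (Fin n)) {y y' : Vec n}
    (h : ∀ j, y j ≤ y' j) : thresholdPotential b w S y ≤ thresholdPotential b w S y' := by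
  have : ∑ j ∈ S, y j * w j ≤ ∑ j ∈ S, y' j * w j :=
    Finset.sum_le_sum fun j _ => mul_le_mul_of_nonneg_right (h j) (w j).2
  unfold thresholdPotential
  split_ifs
  · exact this
  · exact min_le_min_left _ this

theorem thresholdPotential_zero (b : ℝ≥0∞) (w : Fin n → ℝ≥0) (S : Finset (Fin n)) :
    thresholdPotential b w S 0 = 0 := by
  simp [thresholdPotential]

theorem thresholdPotential_single {b : ℝ≥0∞} {w : Fin n → ℝ≥0} {S : Finset (Fin n)}
    (hw : ∀ j ∈ S, (w j : ℝ≥0∞) ≤ b) (j : Fin n) :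
    thresholdPotential b w S (charVec {j}) = if j ∈ S then (w j : ℝ) else 0 := by
  have hs : ∑ k ∈ S, charVec {j} k * (w k : ℝ) = if j ∈ S then (w j : ℝ) else 0 := by
    simp
  rw [thresholdPotential, hs]
  split_ifs with hb hj hj
  · rfl
  · rfl
  · refine min_eq_right ?_
    have := ENNReal.toReal_mono hb (hw j hj)
    simpa using this
  · exact min_eq_right ENNReal.toReal_nonneg

/-- Because `w_j ≤ b`, the potential at a unit vector is the weight itself. This domination carries
convergence of the series from the cube to all real points. -/
theorem abs_thresholdPotential_le {b : ℝ≥0∞} {w : Fin n → ℝ≥0} {S : Finset (Fin n)}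
    (hw : ∀ j ∈ S, (w j : ℝ≥0∞) ≤ b) (y : Vec n) :
    |thresholdPotential b w S y| ≤
      ∑ j, |y j| * thresholdPotential b w S (charVec {j}) := by
  have h1 : ∑ j, |y j| * thresholdPotential b w S (charVec {j}) = ∑ j ∈ S, |y j| * w j := by
    simp only [thresholdPotential_single hw, mul_ite, mul_zero]
    rw [Finset.sum_ite_mem, Finset.univ_inter]
  have h2 : |∑ j ∈ S, y j * w j| ≤ ∑ j ∈ S, |y j| * w j := by
    refine (Finset.abs_sum_le_sum_abs _ _).trans (Finset.sum_le_sum fun j _ => ?_)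
    rw [abs_mul, NNReal.abs_eq]
  rw [h1]
  refine le_trans ?_ h2
  unfold thresholdPotential
  split_ifs
  · exact le_rfl
  · rw [abs_le]
    refine ⟨le_min ?_ (neg_abs_le _), (min_le_right _ _).trans (le_abs_self _)⟩
    exact (neg_nonpos.2 (abs_nonneg _)).trans ENNReal.toReal_nonneg

theorem thresholdPotential_sub_single_le {b : ℝ≥0∞} {w : Fin n → ℝ≥0} {S : Finset (Fin n)}
    (hw : ∀ j ∈ S, (w j : ℝ≥0∞) ≤ b) (y : Vec n) (j : Fin n) :
    thresholdPotential b w S y - thresholdPotential b w S (y - charVec {j}) ≤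
      thresholdPotential b w S (charVec {j}) := by
  rw [thresholdPotential_single hw]
  have hs : ∑ k ∈ S, (y - charVec {j}) k * (w k : ℝ) =
      ∑ k ∈ S, y k * (w k : ℝ) - if j ∈ S then (w j : ℝ) else 0 := by
    simp [sub_mul]
  have h0 : (0 : ℝ) ≤ if j ∈ S then (w j : ℝ) else 0 := by
    split_ifs
    · exact (w j).2
    · exact le_rfl
  unfold thresholdPotential
  rw [hs]
  generalize (if j ∈ S then (w j : ℝ) else 0) = c at *
  split_ifs
  · simp
  · rcases min_choice b.toReal (∑ k ∈ S, y k * (w k : ℝ) - c) with h | h <;> rw [h]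
    · linarith [min_le_left b.toReal (∑ k ∈ S, y k * (w k : ℝ))]
    · linarith [min_le_right b.toReal (∑ k ∈ S, y k * (w k : ℝ))]

theorem WTP.summable_relax (f : WTP.{u} n) (y : Vec n) :
    Summable fun ℓ => (f.c ℓ : ℝ) * thresholdPotential (f.b ℓ) (f.w ℓ) (f.S ℓ) y := by
  have hs : Summable fun ℓ => ∑ j, |y j| *
      ((f.c ℓ : ℝ) * thresholdPotential (f.b ℓ) (f.w ℓ) (f.S ℓ) (charVec {j})) :=
    summable_sum fun j _ => (f.summable {j}).mul_left _
  refine Summable.of_norm_bounded hs fun ℓ => ?_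
  rw [Real.norm_eq_abs, abs_mul, NNReal.abs_eq]
  refine (mul_le_mul_of_nonneg_left (abs_thresholdPotential_le (f.w_le ℓ) y) (f.c ℓ).2).trans ?_
  rw [Finset.mul_sum]
  refine (Finset.sum_congr rfl fun j _ => ?_).le
  rw [NNReal.val_eq_coe]
  ring

theorem WTP.relax_mono (f : WTP.{u} n) {y y' : Vec n} (h : ∀ j, y j ≤ y' j) :
    f.relax y ≤ f.relax y' :=
  (f.summable_relax y).tsum_le_tsum (fun ℓ => mul_le_mul_of_nonneg_left
    (thresholdPotential_mono _ _ _ h) (f.c ℓ).2) (f.summable_relax y')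

theorem WTP.relax_zero (f : WTP.{u} n) : f.relax 0 = 0 := by
  simp [WTP.relax, thresholdPotential_zero]

theorem WTP.relax_sub_single_le (f : WTP.{u} n) (y : Vec n) (j : Fin n) :
    f.relax y - f.relax (y - charVec {j}) ≤ f.relax (charVec {j}) := by
  unfold WTP.relax
  rw [← (f.summable_relax y).tsum_sub (f.summable_relax _)]
  refine ((f.summable_relax y).sub (f.summable_relax _)).tsum_le_tsum (fun ℓ => ?_)
    (f.summable_relax _)
  rw [← mul_sub]
  exact mul_le_mul_of_nonneg_left (thresholdPotential_sub_single_le (f.w_le ℓ) y j) (f.c ℓ).2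

end Threshold

/-! ## The polytope `conv 𝒳` and the size of supergradients on it -/

section Polytope

variable {n : ℕ} {M : Matroid (Fin n)}

theorem charVec_mem_fracSet (A : IndepSets M) : charVec A.1 ∈ fracSet M :=
  subset_convexHull ℝ _ ⟨A, rfl⟩

theorem zero_mem_fracSet : (0 : Vec n) ∈ fracSet M := by
  rw [← charVec_empty]
  exact charVec_mem_fracSet ⟨∅, by simp⟩

theorem convex_fracSet : Convex ℝ (fracSet M) := convex_convexHull ℝ _

theorem isCompact_fracSet : IsCompact (fracSet M) := by
  refine Set.Finite.isCompact_convexHull ℝ ?_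
  refine (Set.finite_range fun A : IndepSets M => charVec A.1).subset ?_
  rintro _ ⟨A, rfl⟩
  exact ⟨A, rfl⟩

theorem fracSet_apply_mem_Icc {y : Vec n} (hy : y ∈ fracSet M) (j : Fin n) :
    y j ∈ Set.Icc (0 : ℝ) 1 := by
  have hc : Convex ℝ {v : Vec n | v j ∈ Set.Icc (0 : ℝ) 1} := by
    intro v hv v' hv' a b ha hb hab
    simpa using convex_Icc (0 : ℝ) 1 hv hv' ha hb hab
  refine convexHull_min ?_ hc hy
  rintro _ ⟨A, rfl⟩
  simp only [Set.mem_ofPred_eq, charVec_apply]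
  split_ifs <;> simp

theorem fracSet_apply_eq_zero {j : Fin n} (hj : ¬ M.Indep {j}) {y : Vec n} (hy : y ∈ fracSet M) :
    y j = 0 := by
  have hc : Convex ℝ {v : Vec n | v j = 0} := by
    intro v hv v' hv' a b _ _ _
    simp only [Set.mem_ofPred_eq] at hv hv'
    simp [hv, hv']
  refine convexHull_min ?_ hc hy
  rintro _ ⟨A, rfl⟩
  have : j ∉ A.1 := fun h => hj (A.2.subset (by simpa using h))
  simp [this]

/-- The supergradient inequality is tested at `y ± e_j`, points that may lie outside the polytope:
monotonicity gives the lower bound, and the bounded loss on subtracting `e_j` the upper one. -/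
theorem IsSupergradient.apply_mem_Icc {f : WTP.{u} n} {y g : Vec n}
    (hg : IsSupergradient f.relax y g) (j : Fin n) :
    g j ∈ Set.Icc (0 : ℝ) (f.relax (charVec {j})) := by
  have hin : inner ℝ g (charVec {j}) = g j := by
    simp [PiLp.inner_apply]
  constructor
  · have h1 := hg (y + charVec {j})
    have h2 : f.relax y ≤ f.relax (y + charVec {j}) := f.relax_mono fun k => by
      simp only [PiLp.add_apply, charVec_apply]
      split_ifs <;> simp
    rw [sub_add_cancel_left, inner_neg_right, hin] at h1
    linarith
  · have h1 := hg (y - charVec {j})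
    rw [sub_sub_cancel, hin] at h1
    exact h1.trans (f.relax_sub_single_le y j)

/-- If `{j}` is independent, then `0` and `e_j` both lie in the polytope and the Lipschitz bound
gives `g_j ≤ L`. Otherwise `g_j` may be large, but coordinate `j` vanishes on the polytope. -/
theorem IsSupergradient.inner_sub_le {f : WTP.{u} n} {L : ℝ≥0}
    (hf : LipschitzOnWith L f.relax (fracSet M)) {y₀ g : Vec n}
    (hg : IsSupergradient f.relax y₀ g) {y y' : Vec n} (hy : y ∈ fracSet M)
    (hy' : y' ∈ fracSet M) : inner ℝ g (y - y') ≤ L * n * ‖y - y'‖ := by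
  have key : ∀ j, g j * (y - y') j ≤ L * ‖y - y'‖ := by
    intro j
    by_cases hj : M.Indep {j}
    · have hmem : charVec {j} ∈ fracSet M := charVec_mem_fracSet ⟨{j}, by simpa using hj⟩
      have h1 := hg.apply_mem_Icc j
      have h2 := hf.dist_le_mul _ hmem _ zero_mem_fracSet
      have h3 : ‖charVec {j}‖ ≤ 1 := by
        have : charVec {j} = EuclideanSpace.single j (1 : ℝ) := by
          ext k; simp
        rw [this]; simp
      rw [f.relax_zero, dist_zero_right, dist_zero_right] at h2
      have h4 : g j ≤ L := h1.2.trans ((le_abs_self _).trans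
        (h2.trans (mul_le_of_le_one_right L.2 h3)))
      have h5 : |(y - y') j| ≤ ‖y - y'‖ := PiLp.norm_apply_le (y - y') j
      calc g j * (y - y') j ≤ g j * |(y - y') j| :=
            mul_le_mul_of_nonneg_left (le_abs_self _) h1.1
        _ ≤ L * ‖y - y'‖ := mul_le_mul h4 h5 (abs_nonneg _) L.2
    · rw [PiLp.sub_apply, fracSet_apply_eq_zero hj hy, fracSet_apply_eq_zero hj hy', sub_zero,
        mul_zero]
      positivity
  calc inner ℝ g (y - y') = ∑ j, g j * (y - y') j := by
        simp [PiLp.inner_apply, mul_comm]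
    _ ≤ ∑ _j : Fin n, L * ‖y - y'‖ := Finset.sum_le_sum fun j _ => key j
    _ = L * n * ‖y - y'‖ := by simp; ring

end Polytope

/-! ## The approximation guarantee of the roundings -/

section Approximation

/-- AM-GM with weights `1/D`, where one extra term of value `1` and weight `(D - |S|)/D` makes up
for a support smaller than `D`. -/
theorem prod_one_sub_le_pow {γ : Type*} (S : Finset γ) {a : γ → ℝ}
    (ha : ∀ j ∈ S, a j ≤ 1) {D : ℕ} (hD : 0 < D) (hS : S.card ≤ D) :
    ∏ j ∈ S, (1 - a j) ≤ (1 - (∑ j ∈ S, a j) / D) ^ D := by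
  have hD' : (0 : ℝ) < D := by exact_mod_cast hD
  have hS' : (S.card : ℝ) ≤ D := by exact_mod_cast hS
  have h := Real.geom_mean_le_arith_mean_weighted (Finset.insertNone S)
    (fun o => o.elim ((D - S.card : ℝ) / D) fun _ => 1 / (D : ℝ))
    (fun o => o.elim 1 fun j => 1 - a j)
    (by
      rintro (_ | j) _
      · exact div_nonneg (by linarith) hD'.le
      · exact div_nonneg zero_le_one hD'.le)
    (by
      simp only [Finset.sum_insertNone, Option.elim_none, Option.elim_some, Finset.sum_const,
        nsmul_eq_mul]
      field_simp
      ring)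
    (by
      rintro (_ | j) hj
      · exact zero_le_one
      · have := ha j (by simpa using hj)
        simpa using this)
  simp only [Finset.prod_insertNone, Finset.sum_insertNone, Option.elim_none, Option.elim_some,
    Real.one_rpow, one_mul] at h
  have hnn : ∀ j ∈ S, 0 ≤ 1 - a j := fun j hj => by linarith [ha j hj]
  rw [Real.finsetProd_rpow _ _ hnn] at h
  have hp : 0 ≤ ∏ j ∈ S, (1 - a j) := Finset.prod_nonneg hnn
  have e : (D - S.card : ℝ) / D * 1 + ∑ j ∈ S, 1 / (D : ℝ) * (1 - a j) =
      1 - (∑ j ∈ S, a j) / D := by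
    rw [← Finset.mul_sum, Finset.sum_sub_distrib, Finset.sum_const, nsmul_eq_mul]
    field_simp
    ring
  rw [e] at h
  have h2 := pow_le_pow_left₀ (Real.rpow_nonneg hp _) h D
  rwa [← Real.rpow_natCast, ← Real.rpow_mul hp, one_div, inv_mul_cancel₀ hD'.ne',
    Real.rpow_one] at h2

/-- For `σ ≥ 1` this is monotonicity; for `σ ≤ 1`, the convex function `x ^ D` lies below its chord
between `1 - 1/D` and `1`. -/
theorem ratio_mul_min_le {D : ℕ} (hD : 0 < D) {σ : ℝ} (h0 : 0 ≤ σ) (hσ : σ ≤ D) :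
    (1 - (1 - 1 / (D : ℝ)) ^ D) * min 1 σ ≤ 1 - (1 - σ / D) ^ D := by
  have hD' : (1 : ℝ) ≤ D := by exact_mod_cast hD
  have hx : 0 ≤ 1 - 1 / (D : ℝ) := by
    rw [sub_nonneg, div_le_one (by linarith)]; exact hD'
  rcases le_total 1 σ with h | h
  · rw [min_eq_left h, mul_one]
    have h1 : (1 - σ / D) ^ D ≤ (1 - 1 / (D : ℝ)) ^ D := by
      refine pow_le_pow_left₀ ?_ ?_ D
      · rw [sub_nonneg, div_le_one (by linarith)]; exact hσ
      · gcongr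
    linarith
  · rw [min_eq_right h]
    have h1 := (convexOn_pow D).2 (Set.mem_Ici.2 zero_le_one) (Set.mem_Ici.2 hx)
      (sub_nonneg.2 h) h0 (by ring)
    have e : (1 - σ) • (1 : ℝ) + σ • (1 - 1 / (D : ℝ)) = 1 - σ / D := by
      simp only [smul_eq_mul]; ring
    rw [e] at h1
    simp only [smul_eq_mul, one_pow] at h1
    linarith

theorem one_sub_prod_le_min {γ : Type*} (S : Finset γ) {a : γ → ℝ}
    (ha : ∀ j ∈ S, a j ∈ Set.Icc (0 : ℝ) 1) :
    1 - ∏ j ∈ S, (1 - a j) ≤ min 1 (∑ j ∈ S, a j) := by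
  refine le_min ?_ ?_
  · have : 0 ≤ ∏ j ∈ S, (1 - a j) := Finset.prod_nonneg fun j hj => sub_nonneg.2 (ha j hj).2
    linarith
  · classical
    induction S using Finset.induction_on with
    | empty => simp
    | insert k S hk ih =>
      have hk1 := ha k (Finset.mem_insert_self k S)
      have hS : ∀ j ∈ S, a j ∈ Set.Icc (0 : ℝ) 1 := fun j hj => ha j (Finset.mem_insert_of_mem hj)
      have hp : ∏ j ∈ S, (1 - a j) ≤ 1 := Finset.prod_le_one
        (fun j hj => sub_nonneg.2 (hS j hj).2) fun j hj => sub_le_self _ (hS j hj).1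
      rw [Finset.prod_insert hk, Finset.sum_insert hk]
      nlinarith [ih hS, mul_le_mul_of_nonneg_left hp hk1.1]

variable {n : ℕ} {M : Matroid (Fin n)} {Ξ : Vec n → PMF (IndepSets M)}

/-- Both roundings do not increase the expectation of a potential that is concave along exchange
directions. -/
theorem exists_rounding_law (hΞ : IsSwapRounding M Ξ ∨ IsPipageRounding M Ξ) {y : Vec n}
    (hy : y ∈ fracSet M) :
    ∃ (z : Fin n ⊕ Fin (matroidRank M) → ℝ) (p : PMF (Finset (Fin n ⊕ Fin (matroidRank M)))),
      (∀ j, z (Sum.inl j) = y j) ∧ (Ξ y).map Subtype.val = p.map Finset.toLeft ∧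
      ∀ Q, ExchangeConcave Q → p.expect (fun A => Q (charFun A)) ≤ Q z := by
  rcases hΞ with h | h
  · obtain ⟨z, p, _, hzy, hp, hmap⟩ := h y hy
    exact ⟨z, p, hzy, hmap, fun Q hQ => hp.expect_le hQ⟩
  · obtain ⟨z, p, _, hzy, hp, hmap⟩ := h y hy
    exact ⟨z, p, hzy, hmap, fun Q hQ => hp.expect_le hQ⟩

/-- A potential that ignores the dummy coordinates sees neither the lift to the base polytope nor
the removal of the dummies. -/
theorem rounding_expect_le (hΞ : IsSwapRounding M Ξ ∨ IsPipageRounding M Ξ) {y : Vec n}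
    (hy : y ∈ fracSet M) {Q : (Fin n → ℝ) → ℝ}
    (hQ : ExchangeConcave fun z : Fin n ⊕ Fin (matroidRank M) → ℝ => Q fun j => z (Sum.inl j)) :
    (Ξ y).expect (fun A => Q (charFun A.1)) ≤ Q y := by
  obtain ⟨z, p, hz, hmap, hp⟩ := exists_rounding_law hΞ hy
  have h1 : (Ξ y).expect (fun A => Q (charFun A.1)) =
      ((Ξ y).map Subtype.val).expect fun A => Q (charFun A) :=
    ((Ξ y).expect_map Subtype.val fun A => Q (charFun A)).symm
  have h2 := hp _ hQ
  simp only [hz] at h2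
  rw [h1, hmap, PMF.expect_map]
  convert h2 using 3 with A
  simp only [Function.comp_apply]
  congr 1
  funext j
  simp [charFun]

theorem rounding_threshold_le (hΞ : IsSwapRounding M Ξ ∨ IsPipageRounding M Ξ) {y : Vec n}
    (hy : y ∈ fracSet M) {b : ℝ≥0∞} {w : Fin n → ℝ≥0} {S : Finset (Fin n)}
    (hw : ∀ j ∈ S, (w j : ℝ≥0∞) ≤ b) {D : ℕ} (hD : 0 < D) (hS : S.card ≤ D) :
    (1 - (1 - 1 / (D : ℝ)) ^ D) * thresholdPotential b w S y ≤
      (Ξ y).expect fun A => thresholdPotential b w S (charVec A.1) := by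
  have hD' : (1 : ℝ) ≤ D := by exact_mod_cast hD
  have hy01 := fracSet_apply_mem_Icc hy
  by_cases hb : b = ⊤
  -- Without a threshold the potential is linear; with negated weights the rounding bound says its
  -- expectation does not decrease, and the ratio is at most `1`.
  · have hlin := exchangeConcave_linear S (Sum.inl : Fin n → Fin n ⊕ Fin (matroidRank M))
      (fun j => -(w j : ℝ))
    have h := rounding_expect_le hΞ hy (Q := fun z => ∑ j ∈ S, z j * -(w j : ℝ)) hlin
    have hx : 0 ≤ (1 - 1 / (D : ℝ)) ^ D := by
      refine pow_nonneg ?_ _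
      rw [sub_nonneg, div_le_one (by linarith)]; exact hD'
    have hnn : 0 ≤ ∑ j ∈ S, y j * (w j : ℝ) :=
      Finset.sum_nonneg fun j _ => mul_nonneg (hy01 j).1 (w j).2
    simp only [thresholdPotential, hb, if_true]
    simp only [mul_neg, Finset.sum_neg_distrib] at h
    have e : (Ξ y).expect (fun A => -∑ j ∈ S, charFun A.1 j * (w j : ℝ)) =
        -(Ξ y).expect fun A => ∑ j ∈ S, charVec A.1 j * (w j : ℝ) := by
      rw [← neg_one_mul, ← PMF.expect_const_mul]
      simp only [neg_one_mul]
      rfl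
    rw [e] at h
    nlinarith [mul_nonneg hx hnn]
  · lift b to ℝ≥0 using hb with β
    have hb : (β : ℝ≥0∞) ≠ ⊤ := ENNReal.coe_ne_top
    have hw' : ∀ j ∈ S, w j ≤ β := fun j hj => by exact_mod_cast hw j hj
    -- A zero threshold forces zero weights on `S`; otherwise everything is rescaled to threshold
    -- `1`.
    rcases eq_or_ne β 0 with rfl | hβ
    · have : ∀ y : Vec n, thresholdPotential ((0 : ℝ≥0) : ℝ≥0∞) w S y = 0 := fun y => by
        have : ∑ j ∈ S, y j * (w j : ℝ) = 0 := Finset.sum_eq_zero fun j hj => by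
          have : w j = 0 := le_antisymm (hw' j hj) (zero_le (a := w j))
          simp [this]
        simp [thresholdPotential, this]
      simp only [this, PMF.expect_const, mul_zero, le_refl]
    · have hβ0 : (0 : ℝ) < β := by exact_mod_cast pos_iff_ne_zero.2 hβ
      set v : Fin n → ℝ := fun j => w j / β with hv
      have hv01 : ∀ j ∈ S, v j ∈ Set.Icc (0 : ℝ) 1 := fun j hj =>
        ⟨by positivity, div_le_one_of_le₀ (by exact_mod_cast hw' j hj) hβ0.le⟩
      have hthr : ∀ y : Vec n, thresholdPotential (β : ℝ≥0∞) w S y =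
          β * min 1 (∑ j ∈ S, v j * y j) := fun y => by
        rw [thresholdPotential, if_neg hb, ENNReal.coe_toReal, mul_min_of_nonneg _ _ hβ0.le,
          mul_one, Finset.mul_sum]
        congr 1
        refine Finset.sum_congr rfl fun j _ => ?_
        rw [hv]
        field_simp
      have hmul : ∀ x : Fin n → ℝ, (∀ j, x j ∈ Set.Icc (0 : ℝ) 1) →
          ∀ j ∈ S, v j * x j ∈ Set.Icc (0 : ℝ) 1 := fun x hx j hj =>
        ⟨mul_nonneg (hv01 j hj).1 (hx j).1, mul_le_one₀ (hv01 j hj).2 (hx j).1 (hx j).2⟩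
      have hround := rounding_expect_le hΞ hy (Q := fun z => ∏ j ∈ S, (1 - v j * z j))
        (exchangeConcave_prod S Sum.inl_injective v hv01)
      have hlow : 1 - (Ξ y).expect (fun A => ∏ j ∈ S, (1 - v j * charFun A.1 j)) ≤
          (Ξ y).expect fun A => min 1 (∑ j ∈ S, v j * charFun A.1 j) := by
        have h1 : (Ξ y).expect (fun _ => (1 : ℝ)) ≤
            (Ξ y).expect fun A => min 1 (∑ j ∈ S, v j * charFun A.1 j) +
              ∏ j ∈ S, (1 - v j * charFun A.1 j) := by
          refine PMF.expect_mono _ fun A => ?_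
          have := one_sub_prod_le_min S (hmul (charFun A.1) fun j =>
            ⟨charFun_nonneg A.1 j, charFun_le_one A.1 j⟩)
          linarith
        rw [PMF.expect_const, PMF.expect_add] at h1
        linarith
      have hS' : (S.card : ℝ) ≤ D := by exact_mod_cast hS
      have hσ : ∑ j ∈ S, v j * y j ≤ D := by
        refine le_trans ?_ hS'
        simpa using Finset.sum_le_card_nsmul S _ (1 : ℝ) fun j hj => (hmul _ hy01 j hj).2
      have h2 := prod_one_sub_le_pow S (fun j hj => (hmul _ hy01 j hj).2) hD hS
      have h3 := ratio_mul_min_le hD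
        (Finset.sum_nonneg fun j hj => (hmul _ hy01 j hj).1) hσ
      have h4 : (1 - (1 - 1 / (D : ℝ)) ^ D) * min 1 (∑ j ∈ S, v j * y j) ≤
          (Ξ y).expect fun A => min 1 (∑ j ∈ S, v j * charFun A.1 j) := by
        simp only at hround
        linarith
      simp only [hthr]
      rw [PMF.expect_const_mul, mul_left_comm]
      exact mul_le_mul_of_nonneg_left h4 hβ0.le

theorem WTP.card_le_maxDegree {𝓕 : Set (WTP.{u} n)} {f : WTP.{u} n} (hf : f ∈ 𝓕) (ℓ : f.C) :
    (f.S ℓ).card ≤ maxDegree 𝓕 := by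
  have hcard : ∀ (f : WTP.{u} n) (ℓ : f.C), (f.S ℓ).card ≤ n := fun f ℓ => by
    simpa using Finset.card_le_univ (f.S ℓ)
  have hdeg : ∀ f : WTP.{u} n, f.degree ≤ n := fun f => ciSup_le' (hcard f)
  refine (le_ciSup (f := fun ℓ => (f.S ℓ).card) ⟨n, ?_⟩ ℓ).trans (le_csSup ⟨n, ?_⟩ ⟨f, hf, rfl⟩)
  · rintro _ ⟨ℓ, rfl⟩; exact hcard f ℓ
  · rintro _ ⟨f, _, rfl⟩; exact hdeg f

theorem wtpRatio_mem_Icc (𝓕 : Set (WTP.{u} n)) : wtpRatio 𝓕 ∈ Set.Icc (0 : ℝ) 1 := by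
  have h0 : 0 ≤ 1 - 1 / (maxDegree 𝓕 : ℝ) := by
    rcases (maxDegree 𝓕).eq_zero_or_pos with h | h
    · simp [h]
    · have : (1 : ℝ) ≤ maxDegree 𝓕 := by exact_mod_cast h
      rw [sub_nonneg, div_le_one (by linarith)]; exact this
  have h1 : 1 - 1 / (maxDegree 𝓕 : ℝ) ≤ 1 := by
    have : 0 ≤ 1 / (maxDegree 𝓕 : ℝ) := by positivity
    linarith
  exact ⟨sub_nonneg.2 (pow_le_one₀ h0 h1), sub_le_self _ (pow_nonneg h0 _)⟩

/-- The rounding preserves the value of a weighted threshold potential up to the factor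
`wtpRatio`. -/
theorem wtpRatio_mul_relax_le (hΞ : IsSwapRounding M Ξ ∨ IsPipageRounding M Ξ) {y : Vec n}
    (hy : y ∈ fracSet M) {𝓕 : Set (WTP.{u} n)} {f : WTP.{u} n} (hf : f ∈ 𝓕) :
    wtpRatio 𝓕 * f.relax y ≤ (Ξ y).expect fun A => f.eval A.1 := by
  have e : (Ξ y).expect (fun A => f.eval A.1) = ∑' ℓ, (f.c ℓ : ℝ) *
      (Ξ y).expect fun A => thresholdPotential (f.b ℓ) (f.w ℓ) (f.S ℓ) (charVec A.1) := by
    simp only [← PMF.expect_const_mul]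
    simp only [PMF.expect, WTP.eval, WTP.relax, ← tsum_mul_left]
    exact (Summable.tsum_finsetSum fun A _ => (f.summable_relax _).mul_left _).symm
  have hs : Summable fun ℓ => (f.c ℓ : ℝ) *
      (Ξ y).expect fun A => thresholdPotential (f.b ℓ) (f.w ℓ) (f.S ℓ) (charVec A.1) := by
    simp only [← PMF.expect_const_mul]
    exact summable_sum fun A _ => (f.summable_relax _).mul_left _
  rw [e, WTP.relax, ← tsum_mul_left]
  refine ((f.summable_relax y).mul_left _).tsum_le_tsum (fun ℓ => ?_) hs
  rw [mul_left_comm]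
  refine mul_le_mul_of_nonneg_left ?_ (f.c ℓ).2
  have hcard := f.card_le_maxDegree hf ℓ
  -- In degree `0` all supports are empty and both sides vanish.
  rcases (maxDegree 𝓕).eq_zero_or_pos with h | h
  · have hS : f.S ℓ = ∅ := Finset.card_eq_zero.1 (by omega)
    simp [wtpRatio, h, hS, thresholdPotential, PMF.expect_const]
  · exact rounding_threshold_le hΞ hy (f.w_le ℓ) h hcard

end Approximation

/-! ## Strong convexity with respect to a norm on `ℝⁿ` -/

section StrongConvexity

variable {n : ℕ}

/-- The minimum over the compact unit sphere is positive (the sphere is empty if `n = 0`). This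
converts the Euclidean gradient bound to the norm of the strong convexity assumption. -/
theorem Seminorm.exists_norm_le_of_definite (N : Seminorm ℝ (Vec n)) (hN : ∀ v, N v = 0 → v = 0) :
    ∃ c : ℝ, 0 ≤ c ∧ ∀ v, ‖v‖ ≤ c * N v := by
  have hcont : Continuous N := (N.convexOn.locallyLipschitz).continuous
  have hcompact : IsCompact (Metric.sphere (0 : Vec n) 1) := isCompact_sphere 0 1
  rcases (Metric.sphere (0 : Vec n) 1).eq_empty_or_nonempty with he | hne
  · refine ⟨0, le_rfl, fun v => ?_⟩
    by_contra hv
    have hv0 : ‖v‖ ≠ 0 := fun h => hv (by simp [h])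
    have : (‖v‖⁻¹ • v) ∈ Metric.sphere (0 : Vec n) 1 := by
      simp [norm_smul, inv_mul_cancel₀ hv0]
    simp [he] at this
  · obtain ⟨v₀, hv₀, hmin⟩ := hcompact.exists_isMinOn hne hcont.continuousOn
    have hpos : 0 < N v₀ := by
      refine lt_of_le_of_ne (apply_nonneg N v₀) fun h => ?_
      have := hN v₀ h.symm
      simp [this] at hv₀
    refine ⟨(N v₀)⁻¹, (inv_pos.2 hpos).le, fun v => ?_⟩
    rcases eq_or_ne v 0 with rfl | hv
    · simp
    have hv0 : 0 < ‖v‖ := norm_pos_iff.2 hv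
    have hmem : (‖v‖⁻¹ • v) ∈ Metric.sphere (0 : Vec n) 1 := by
      simp [norm_smul, inv_mul_cancel₀ hv0.ne']
    have h1 : N v₀ ≤ N (‖v‖⁻¹ • v) := hmin hmem
    rw [map_smul_eq_mul, Real.norm_eq_abs, abs_of_pos (inv_pos.2 hv0), inv_mul_eq_div,
      le_div_iff₀ hv0] at h1
    rw [inv_mul_eq_div, le_div_iff₀ hpos]
    linarith

/-- Strong convexity bounds the difference quotients from `x` towards `y`; the limit `t → 0⁺` turns
them into the gradient term. -/
theorem StronglyConvexOnWrt.le_bregman {N : Seminorm ℝ (Vec n)} {D : Set (Vec n)} {ρ : ℝ}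
    {Φ : Vec n → ℝ} (h : StronglyConvexOnWrt N D ρ Φ) {x y : Vec n} (hx : x ∈ D) (hy : y ∈ D)
    (hΦ : DifferentiableAt ℝ Φ x) : ρ / 2 * N (y - x) ^ 2 ≤ bregman Φ y x := by
  have hder : HasDerivAt (fun t : ℝ => Φ (x + t • (y - x))) (inner ℝ (gradient Φ x) (y - x)) 0 := by
    have h1 : HasFDerivAt Φ (InnerProductSpace.toDual ℝ (Vec n) (gradient Φ x))
        (x + (0 : ℝ) • (y - x)) := by
      rw [zero_smul, add_zero]
      exact hΦ.hasGradientAt.hasFDerivAt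
    have h2 : HasDerivAt (fun t : ℝ => x + t • (y - x)) (y - x) 0 := by
      simpa using ((hasDerivAt_id (0 : ℝ)).smul_const (y - x)).const_add x
    exact h1.comp_hasDerivAt 0 h2
  have hlim := hder.tendsto_slope_zero_right
  have hlim2 : Filter.Tendsto (fun t : ℝ => Φ y - Φ x - (1 - t) * (ρ / 2 * N (y - x) ^ 2))
      (nhdsWithin 0 (Set.Ioi 0)) (nhds (Φ y - Φ x - (1 - 0) * (ρ / 2 * N (y - x) ^ 2))) :=
    Filter.Tendsto.mono_left (Continuous.tendsto (by fun_prop) 0) nhdsWithin_le_nhds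
  have hle := le_of_tendsto_of_tendsto hlim hlim2 (by
    filter_upwards [Ioc_mem_nhdsGT (zero_lt_one' ℝ)] with t ht
    have hc := h.2 y hy x hx t (1 - t) ht.1.le (sub_nonneg.2 ht.2) (by ring)
    have e : t • y + (1 - t) • x = x + t • (y - x) := by
      rw [smul_sub, sub_smul, one_smul]; abel
    rw [e] at hc
    simp only [zero_add, zero_smul, add_zero, smul_eq_mul]
    rw [inv_mul_le_iff₀ ht.1]
    linarith)
  unfold bregman
  linarith

theorem StronglyConvexOnWrt.add_inner {N : Seminorm ℝ (Vec n)} {Y : Set (Vec n)} {ρ : ℝ}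
    {R : Vec n → ℝ} (h : StronglyConvexOnWrt N Y ρ R) (c : ℝ) (g : Vec n) :
    StronglyConvexOnWrt N Y ρ fun y => c * inner ℝ g y + R y := by
  refine ⟨h.1, fun x hx y hy a b ha hb hab => ?_⟩
  have := h.2 x hx y hy a b ha hb hab
  simp only [inner_add_right, inner_smul_right]
  linarith

theorem StronglyConvexOnWrt.le_sub_of_isMin {N : Seminorm ℝ (Vec n)} {Y : Set (Vec n)} {ρ : ℝ}
    {F : Vec n → ℝ} (h : StronglyConvexOnWrt N Y ρ F) {p y : Vec n} (hp : p ∈ Y)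
    (hmin : ∀ y ∈ Y, F p ≤ F y) (hy : y ∈ Y) : ρ / 2 * N (y - p) ^ 2 ≤ F y - F p := by
  have hlim : Filter.Tendsto (fun t : ℝ => (1 - t) * (ρ / 2 * N (y - p) ^ 2))
      (nhdsWithin 0 (Set.Ioi 0)) (nhds ((1 - 0) * (ρ / 2 * N (y - p) ^ 2))) :=
    Filter.Tendsto.mono_left (Continuous.tendsto (by fun_prop) 0) nhdsWithin_le_nhds
  rw [sub_zero, one_mul] at hlim
  refine le_of_tendsto hlim ?_
  filter_upwards [Ioc_mem_nhdsGT (zero_lt_one' ℝ)] with t ht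
  have hc := h.2 y hy p hp t (1 - t) ht.1.le (sub_nonneg.2 ht.2) (by ring)
  have hm := hmin _ (h.1 hy hp ht.1.le (sub_nonneg.2 ht.2) (by ring))
  refine le_of_mul_le_mul_left ?_ ht.1
  linarith

end StrongConvexity

/-! ## Regret of the OCO methods -/

section Regret

variable {n : ℕ}

/-- The point that an OCO policy plays at time `t` against an infinite sequence of rewards. -/
noncomputable def OCOPolicy.play (P : OCOPolicy n) (g : ℕ → Vec n → ℝ) (t : ℕ) : Vec n :=
  P t (P.points t fun s : Fin t => g s) fun s : Fin t => g s

theorem OCOPolicy.points_eq_play (P : OCOPolicy n) (g : ℕ → Vec n → ℝ) (t : ℕ) :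
    (P.points t fun s : Fin t => g s) = fun s : Fin t => P.play g s := by
  induction t with
  | zero => exact funext fun s => s.elim0
  | succ t ih =>
    funext s
    refine Fin.lastCases ?_ (fun s => ?_) s
    · exact Fin.snoc_last (α := fun _ => Vec n) _ _
    · exact (Fin.snoc_castSucc (α := fun _ => Vec n) _ _ s).trans (congrFun ih s)

theorem OCOPolicy.play_eq (P : OCOPolicy n) (g : ℕ → Vec n → ℝ) (t : ℕ) :
    P.play g t = P t (fun s : Fin t => P.play g s) fun s : Fin t => g s := by
  rw [OCOPolicy.play, P.points_eq_play]

/-- A linear term is dominated by a quadratic one. -/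
theorem mul_mul_le_of_sq {η C ρ x : ℝ} (hρ : 0 < ρ) :
    η * (C * x) ≤ η ^ 2 * (C ^ 2 / (2 * ρ)) + ρ / 2 * x ^ 2 := by
  have h : 0 ≤ (η * C - ρ * x) ^ 2 / (2 * ρ) := by positivity
  have e : (η * C - ρ * x) ^ 2 / (2 * ρ) =
      η ^ 2 * (C ^ 2 / (2 * ρ)) + ρ / 2 * x ^ 2 - η * (C * x) := by
    field_simp
    ring
  linarith

/-- Telescoping of the one-step inequality of mirror-ascent-like methods. -/
theorem sum_inner_le_of_step {N : Seminorm ℝ (Vec n)} {ρ C η : ℝ} (hρ : 0 < ρ) (hη : 0 ≤ η)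
    {y γ : ℕ → Vec n} {u : Vec n} {V : ℕ → ℝ} (hV : ∀ t, 0 ≤ V t)
    (hγ : ∀ t, inner ℝ (γ t) (y (t + 1) - y t) ≤ C * N (y (t + 1) - y t))
    (hstep : ∀ t, η * inner ℝ (γ t) (u - y (t + 1)) ≤
      V t - V (t + 1) - ρ / 2 * N (y (t + 1) - y t) ^ 2) (T : ℕ) :
    η * ∑ t ∈ Finset.range T, inner ℝ (γ t) (u - y t) ≤ V 0 + T * η ^ 2 * (C ^ 2 / (2 * ρ)) := by
  have main : ∀ T : ℕ, η * ∑ t ∈ Finset.range T, inner ℝ (γ t) (u - y t) ≤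
      V 0 - V T + T * η ^ 2 * (C ^ 2 / (2 * ρ)) := by
    intro T
    induction T with
    | zero => simp
    | succ T ih =>
      have h1 := hstep T
      have h2 := mul_le_mul_of_nonneg_left (hγ T) hη
      -- The movement cost is linear in the step, so the quadratic term in `hstep` absorbs it up to
      -- `O(η²)`.
      have h3 := mul_mul_le_of_sq (η := η) (C := C) (x := N (y (T + 1) - y T)) hρ
      have e : inner ℝ (γ T) (u - y T) =
          inner ℝ (γ T) (u - y (T + 1)) + inner ℝ (γ T) (y (T + 1) - y T) := by
        rw [← inner_add_right, sub_add_sub_cancel]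
      rw [Finset.sum_range_succ, mul_add, e, mul_add]
      push_cast
      linarith
  have := main T
  linarith [hV T]

theorem bregman_three_point (Φ : Vec n → ℝ) (u p y : Vec n) :
    inner ℝ (gradient Φ p - gradient Φ y) (u - p) =
      bregman Φ u y - bregman Φ u p - bregman Φ p y := by
  unfold bregman
  simp only [inner_sub_left, inner_sub_right]
  ring

/-- First-order optimality: the gradient of `D_Φ(·, z)` at `p` is `∇Φ(p) - ∇Φ(z)`. -/
theorem IsBregmanProj.inner_nonneg {Φ : Vec n → ℝ} {S : Set (Vec n)} {z p : Vec n}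
    (h : IsBregmanProj Φ S z p) (hS : Convex ℝ S) (hΦ : DifferentiableAt ℝ Φ p) {u : Vec n}
    (hu : u ∈ S) : 0 ≤ inner ℝ (gradient Φ p - gradient Φ z) (u - p) := by
  have hmin : IsLocalMinOn (fun y => bregman Φ y z) S p :=
    Filter.eventually_of_mem self_mem_nhdsWithin fun y hy => h.2 y hy
  have hder : HasFDerivAt (fun y => bregman Φ y z)
      (InnerProductSpace.toDual ℝ (Vec n) (gradient Φ p) -
        InnerProductSpace.toDual ℝ (Vec n) (gradient Φ z)) p := by
    have h1 := hΦ.hasGradientAt.hasFDerivAt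
    have h2 : HasFDerivAt (fun y => inner ℝ (gradient Φ z) (y - z))
        (InnerProductSpace.toDual ℝ (Vec n) (gradient Φ z)) p :=
      (InnerProductSpace.toDual ℝ (Vec n) (gradient Φ z)).hasFDerivAt.comp p
        ((hasFDerivAt_id p).sub_const z)
    exact (h1.sub_const (Φ z)).sub h2
  have := hmin.hasFDerivWithinAt_nonneg hder.hasFDerivWithinAt
    (sub_mem_posTangentConeAt_of_segment_subset (hS.segment_subset h.1 hu))
  simpa [inner_sub_left] using this

theorem inner_le_of_isProj {Y : Set (Vec n)} (hY : Convex ℝ Y) {y v p u : Vec n} (hp : p ∈ Y)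
    (hmin : ∀ y' ∈ Y, ‖y + v - p‖ ≤ ‖y + v - y'‖) (hu : u ∈ Y) :
    inner ℝ v (u - p) ≤ 1 / 2 * ‖u - y‖ ^ 2 - 1 / 2 * ‖u - p‖ ^ 2 - 1 / 2 * ‖p - y‖ ^ 2 := by
  have : Nonempty Y := ⟨⟨p, hp⟩⟩
  have hinf : ‖y + v - p‖ = ⨅ w : Y, ‖y + v - w‖ :=
    le_antisymm (le_ciInf fun w => hmin w w.2)
      (ciInf_le (f := fun w : Y => ‖y + v - w‖) ⟨0, by rintro _ ⟨w, rfl⟩; exact norm_nonneg _⟩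
        ⟨p, hp⟩)
  have h := (norm_eq_iInf_iff_real_inner_le_zero hY hp).1 hinf u hu
  have e1 : inner ℝ (y + v - p) (u - p) = inner ℝ v (u - p) - inner ℝ (p - y) (u - p) := by
    rw [← inner_sub_left]; congr 1; abel
  have e2 : ‖u - y‖ ^ 2 = ‖u - p‖ ^ 2 + 2 * inner ℝ (p - y) (u - p) + ‖p - y‖ ^ 2 := by
    rw [real_inner_comm, ← norm_add_sq_real, sub_add_sub_cancel]
  linarith

variable {Y : Set (Vec n)}

theorem oga_regret (hY : Convex ℝ Y) (hYc : IsCompact Y) {y₁ : Vec n} (hy₁ : y₁ ∈ Y) (C : ℝ) :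
    ∃ K : ℝ, 0 ≤ K ∧ ∀ (𝓖 : Set (Vec n → ℝ)) (G : (Vec n → ℝ) → Vec n → Vec n) (η : ℝ)
      (P : OCOPolicy n), 0 ≤ η →
      (∀ f ∈ 𝓖, ∀ y ∈ Y, ∀ u ∈ Y, ∀ v ∈ Y, inner ℝ (G f y) (u - v) ≤ C * ‖u - v‖) →
      (OCOMethod.oga y₁).IsPolicy Y 𝓖 G η P → ∀ g : ℕ → Vec n → ℝ, (∀ t, g t ∈ 𝓖) →
      (∀ t, P.play g t ∈ Y) ∧ ∀ (T : ℕ), ∀ u ∈ Y,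
        η * ∑ t ∈ Finset.range T, inner ℝ (G (g t) (P.play g t)) (u - P.play g t) ≤
          K + T * η ^ 2 * K := by
  obtain ⟨B, hB⟩ := hYc.exists_bound_of_continuousOn
    (f := fun u => 1 / 2 * ‖u - y₁‖ ^ 2) (by fun_prop)
  have hB' : ∀ u ∈ Y, 1 / 2 * ‖u - y₁‖ ^ 2 ≤ |B| := fun u hu =>
    (le_abs_self _).trans ((hB u hu).trans (le_abs_self B))
  refine ⟨|B| + C ^ 2 / (2 * 1), by positivity, fun 𝓖 G η P hη hG hP g hg => ?_⟩
  have h0 : P.play g 0 = y₁ := by rw [P.play_eq]; exact hP.1 _ _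
  have hmem : ∀ t, P.play g t ∈ Y := by
    intro t
    induction t using Nat.strong_induction_on with
    | _ t ih =>
      cases t with
      | zero => rwa [h0]
      | succ t =>
        rw [P.play_eq]
        exact (hP.2 t _ _ (fun s => ih s s.2) fun s => hg s).1
  refine ⟨hmem, fun T u hu => ?_⟩
  have h := sum_inner_le_of_step (N := normSeminorm ℝ (Vec n)) (ρ := 1) (C := C) one_pos hη
    (y := P.play g) (γ := fun t => G (g t) (P.play g t)) (u := u)
    (V := fun t => 1 / 2 * ‖u - P.play g t‖ ^ 2) (fun t => by positivity)
    (fun t => hG _ (hg t) _ (hmem t) _ (hmem _) _ (hmem t))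
    (fun t => by
      have h1 := (hP.2 t (fun s => P.play g s) (fun s => g s) (fun s => hmem s) fun s => hg s).2
      rw [← P.play_eq g (t + 1)] at h1
      have h2 := inner_le_of_isProj hY (hmem (t + 1)) h1 hu
      rw [real_inner_smul_left] at h2
      exact h2) T
  simp only [h0] at h
  have h3 : (0 : ℝ) ≤ T * η ^ 2 * |B| := by positivity
  have h4 : 0 ≤ C ^ 2 / (2 * 1) := by positivity
  linarith [hB' u hu]

/-- The telescoping quantity is `D_Φ(u, y_t)`, by the three-point identity and optimality of the
projection. It is controlled only for `u` in `D`. -/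
theorem oma_regret (hY : Convex ℝ Y) {Φ : Vec n → ℝ} {D : Set (Vec n)} {y₁ : Vec n}
    (hA : (OCOMethod.oma Φ D y₁).Admissible Y) {C : ℝ} (hC : 0 ≤ C) :
    ∃ K : ℝ, 0 ≤ K ∧ ∀ (𝓖 : Set (Vec n → ℝ)) (G : (Vec n → ℝ) → Vec n → Vec n) (η : ℝ)
      (P : OCOPolicy n), 0 ≤ η →
      (∀ f ∈ 𝓖, ∀ y ∈ Y, ∀ u ∈ Y, ∀ v ∈ Y, inner ℝ (G f y) (u - v) ≤ C * ‖u - v‖) →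
      (OCOMethod.oma Φ D y₁).IsPolicy Y 𝓖 G η P → ∀ g : ℕ → Vec n → ℝ, (∀ t, g t ∈ 𝓖) →
      (∀ t, P.play g t ∈ Y) ∧ ∀ (T : ℕ), ∀ u ∈ Y,
        η * ∑ t ∈ Finset.range T, inner ℝ (G (g t) (P.play g t)) (u - P.play g t) ≤
          K + T * η ^ 2 * K := by
  obtain ⟨hΦ, hy₁, B, hB⟩ := hA
  obtain ⟨N, ρ, hN, hρ, hsc⟩ := hΦ.stronglyConvex
  obtain ⟨c, hc, hcN⟩ := N.exists_norm_le_of_definite hN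
  have hdiff : ∀ x ∈ D, DifferentiableAt ℝ Φ x := fun x hx =>
    (hΦ.differentiable x hx).differentiableAt (hΦ.isOpen.mem_nhds hx)
  have hconv : Convex ℝ (Y ∩ D) := hY.inter hΦ.convex
  refine ⟨|B| + (C * c) ^ 2 / (2 * ρ), by positivity, fun 𝓖 G η P hη hG hP g hg => ?_⟩
  have h0 : P.play g 0 = y₁ := by rw [P.play_eq]; exact hP.1 _ _
  have hmem : ∀ t, P.play g t ∈ Y ∩ D := by
    intro t
    induction t using Nat.strong_induction_on with
    | _ t ih =>
      cases t with
      | zero => rwa [h0]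
      | succ t =>
        rw [P.play_eq]
        obtain ⟨z, _, _, hz⟩ := hP.2 t _ _ (fun s => ih s s.2) fun s => hg s
        exact hz.1
  refine ⟨fun t => (hmem t).1, fun T => ?_⟩
  have hbound : ∀ u ∈ Y ∩ D,
      η * ∑ t ∈ Finset.range T, inner ℝ (G (g t) (P.play g t)) (u - P.play g t) ≤
        (|B| + (C * c) ^ 2 / (2 * ρ)) + T * η ^ 2 * (|B| + (C * c) ^ 2 / (2 * ρ)) := by
    intro u hu
    have h := sum_inner_le_of_step (N := N) (ρ := ρ) (C := C * c) hρ hη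
      (y := P.play g) (γ := fun t => G (g t) (P.play g t)) (u := u)
      (V := fun t => bregman Φ u (P.play g t))
      (fun t => le_trans (by positivity)
        (hsc.le_bregman (hmem t).2 hu.2 (hdiff _ (hmem t).2)))
      (fun t => by
        rw [mul_assoc]
        exact (hG _ (hg t) _ (hmem t).1 _ (hmem _).1 _ (hmem t).1).trans
          (mul_le_mul_of_nonneg_left (hcN _) hC))
      (fun t => by
        obtain ⟨z, _, hz, hproj⟩ :=
          hP.2 t (fun s => P.play g s) (fun s => g s) (fun s => hmem s) fun s => hg s
        rw [← P.play_eq g (t + 1)] at hproj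
        have h1 := hproj.inner_nonneg hconv (hdiff _ (hmem (t + 1)).2) hu
        have h2 := hsc.le_bregman (hmem t).2 (hmem (t + 1)).2 (hdiff _ (hmem t).2)
        have h3 := bregman_three_point Φ u (P.play g (t + 1)) (P.play g t)
        rw [hz] at h1
        simp only [Fin.val_last] at h1
        rw [← sub_sub, inner_sub_left, h3, real_inner_smul_left] at h1
        linarith) T
    simp only [h0] at h
    have h3 : (0 : ℝ) ≤ T * η ^ 2 * |B| := by positivity
    have h4 : 0 ≤ (C * c) ^ 2 / (2 * ρ) := by positivity
    linarith [hB u hu, le_abs_self B]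
  -- The final bound is a closed condition on `u`, so it passes to comparators on the boundary of
  -- `D`: the open segment from such a point to `y₁` stays in `Y ∩ D`.
  have hclosed : IsClosed {u : Vec n |
      η * ∑ t ∈ Finset.range T, inner ℝ (G (g t) (P.play g t)) (u - P.play g t) ≤
        (|B| + (C * c) ^ 2 / (2 * ρ)) + T * η ^ 2 * (|B| + (C * c) ^ 2 / (2 * ρ))} :=
    isClosed_le (by fun_prop) continuous_const
  intro u hu
  refine closure_minimal (s := Y ∩ D) (fun u hu => hbound u hu) hclosed ?_
  have hseg : openSegment ℝ u y₁ ⊆ Y ∩ D := by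
    refine Set.subset_inter (hY.openSegment_subset hu hy₁.1) ?_
    refine (hΦ.convex.openSegment_closure_interior_subset_interior (hΦ.subset_closure hu)
      (by rw [hΦ.isOpen.interior_eq]; exact hy₁.2)).trans interior_subset
  exact closure_mono hseg (segment_subset_closure_openSegment (left_mem_segment ℝ u y₁))

theorem ftrl_regret (hYc : IsCompact Y) {R : Vec n → ℝ} (hR : IsRegularizer R Y) {C : ℝ}
    (hC : 0 ≤ C) :
    ∃ K : ℝ, 0 ≤ K ∧ ∀ (𝓖 : Set (Vec n → ℝ)) (G : (Vec n → ℝ) → Vec n → Vec n) (η : ℝ)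
      (P : OCOPolicy n), 0 ≤ η →
      (∀ f ∈ 𝓖, ∀ y ∈ Y, ∀ u ∈ Y, ∀ v ∈ Y, inner ℝ (G f y) (u - v) ≤ C * ‖u - v‖) →
      (OCOMethod.ftrl R).IsPolicy Y 𝓖 G η P → ∀ g : ℕ → Vec n → ℝ, (∀ t, g t ∈ 𝓖) →
      (∀ t, P.play g t ∈ Y) ∧ ∀ (T : ℕ), ∀ u ∈ Y,
        η * ∑ t ∈ Finset.range T, inner ℝ (G (g t) (P.play g t)) (u - P.play g t) ≤
          K + T * η ^ 2 * K := by
  obtain ⟨⟨N, hN, hsc⟩, hcont⟩ := hR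
  obtain ⟨c, hc, hcN⟩ := N.exists_norm_le_of_definite hN
  obtain ⟨B, hB⟩ := hYc.exists_bound_of_continuousOn hcont
  have hB' : ∀ u ∈ Y, |R u| ≤ |B| := fun u hu => (hB u hu).trans (le_abs_self B)
  -- The term `2 * |B|` pays for `R u - R (y 0)`.
  refine ⟨2 * |B| + (C * c) ^ 2 / (2 * 1), by positivity, fun 𝓖 G η P hη hG hP g hg => ?_⟩
  set y := P.play g with hy
  set γ : ℕ → Vec n := fun t => G (g t) (y t) with hγ
  have hmem : ∀ t, y t ∈ Y := by
    intro t
    induction t using Nat.strong_induction_on with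
    | _ t ih =>
      rw [hy, P.play_eq]
      exact (hP t _ _ (fun s => ih s s.2) fun s => hg s).1
  set F : ℕ → Vec n → ℝ := fun t v => -η * inner ℝ (∑ s ∈ Finset.range t, γ s) v + R v with hF
  have hmin : ∀ t, ∀ v ∈ Y, F t (y t) ≤ F t v := by
    intro t v hv
    have h := (hP t (fun s => y s) (fun s => g s) (fun s => hmem s) fun s => hg s).2 v hv
    rw [← P.play_eq g t, Fin.sum_univ_eq_sum_range (fun s => inner ℝ (G (g s) (y s)) (P.play g t)),
      Fin.sum_univ_eq_sum_range (fun s => inner ℝ (G (g s) (y s)) v)] at h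
    simp only [hF, sum_inner]
    exact h
  -- The minimum of the objective is tracked from below: by strong convexity `F T (y (T + 1))`
  -- exceeds `F T (y T)` by half the squared step, which offsets the linear gain from moving.
  -- Comparing `F T (y T)` with `F T u` then yields the regret.
  have hlow : ∀ T : ℕ, R (y 0) - η * ∑ t ∈ Finset.range T, inner ℝ (γ t) (y t) -
      T * η ^ 2 * ((C * c) ^ 2 / (2 * 1)) ≤ F T (y T) := by
    intro T
    induction T with
    | zero => simp [hF]
    | succ T ih =>
      have h1 := (hsc.add_inner (-η) (∑ s ∈ Finset.range T, γ s)).le_sub_of_isMin (hmem T)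
        (hmin T) (hmem (T + 1))
      have h2 : inner ℝ (γ T) (y (T + 1) - y T) ≤ C * c * N (y (T + 1) - y T) := by
        rw [mul_assoc]
        exact (hG _ (hg T) _ (hmem T) _ (hmem _) _ (hmem T)).trans
          (mul_le_mul_of_nonneg_left (hcN _) hC)
      have h3 := mul_le_mul_of_nonneg_left h2 hη
      have h4 := mul_mul_le_of_sq (η := η) (C := C * c) (x := N (y (T + 1) - y T)) one_pos
      have e : F (T + 1) (y (T + 1)) = F T (y (T + 1)) - η * inner ℝ (γ T) (y T) -
          η * inner ℝ (γ T) (y (T + 1) - y T) := by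
        simp only [hF, Finset.sum_range_succ, inner_add_left, inner_sub_right]
        ring
      rw [e, Finset.sum_range_succ]
      push_cast
      simp only [hF] at ih h1 ⊢
      linarith
  refine ⟨hmem, fun T u hu => ?_⟩
  have h1 := (hlow T).trans (hmin T u hu)
  have e : η * ∑ t ∈ Finset.range T, inner ℝ (γ t) (u - y t) =
      η * inner ℝ (∑ t ∈ Finset.range T, γ t) u -
        η * ∑ t ∈ Finset.range T, inner ℝ (γ t) (y t) := by
    simp only [sum_inner, inner_sub_right, Finset.sum_sub_distrib, mul_sub]
  change η * ∑ t ∈ Finset.range T, inner ℝ (γ t) (u - y t) ≤ _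
  rw [e]
  simp only [hF] at h1
  have h2 := abs_le.1 (hB' u hu)
  have h3 := abs_le.1 (hB' _ (hmem 0))
  have h4 : (0 : ℝ) ≤ T * η ^ 2 * (2 * |B|) := by positivity
  have h5 : 0 ≤ (C * c) ^ 2 / (2 * 1) := by positivity
  linarith

theorem OCOMethod.regret (A : OCOMethod n) (hY : Convex ℝ Y) (hYc : IsCompact Y)
    (hA : A.Admissible Y) {C : ℝ} (hC : 0 ≤ C) :
    ∃ K : ℝ, 0 ≤ K ∧ ∀ (𝓖 : Set (Vec n → ℝ)) (G : (Vec n → ℝ) → Vec n → Vec n) (η : ℝ)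
      (P : OCOPolicy n), 0 ≤ η →
      (∀ f ∈ 𝓖, ∀ y ∈ Y, ∀ u ∈ Y, ∀ v ∈ Y, inner ℝ (G f y) (u - v) ≤ C * ‖u - v‖) →
      A.IsPolicy Y 𝓖 G η P → ∀ g : ℕ → Vec n → ℝ, (∀ t, g t ∈ 𝓖) →
      (∀ t, P.play g t ∈ Y) ∧ ∀ (T : ℕ), ∀ u ∈ Y,
        η * ∑ t ∈ Finset.range T, inner ℝ (G (g t) (P.play g t)) (u - P.play g t) ≤
          K + T * η ^ 2 * K := by
  cases A with
  | oga y₁ => exact oga_regret hY hYc hA C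
  | oma Φ D y₁ => exact oma_regret hY hA hC
  | ftrl R => exact ftrl_regret hYc hA hC

end Regret

/-! ## The `α`-regret of RAOCO -/

section AlphaRegret

variable {n : ℕ} {M : Matroid (Fin n)}

theorem OnlinePolicy.expectedReward_succ {X F : Type*} [Fintype X] (P : OnlinePolicy X F)
    (val : F → X → ℝ) (T : ℕ) (f : Fin (T + 1) → F) :
    P.expectedReward val (T + 1) f = P.expectedReward val T (Fin.init f) +
      (P.law T (Fin.init f)).expect fun xs =>
        (P T xs (Fin.init f)).expect fun x => val (f (Fin.last T)) x := by
  change (P.law (T + 1) f).expect (fun xs => ∑ t, val (f t) (xs t)) =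
    (P.law T (Fin.init f)).expect (fun xs => ∑ t, val (Fin.init f t) (xs t)) + _
  rw [OnlinePolicy.law, PMF.expect_bind, ← PMF.expect_add]
  congr 1
  funext xs
  rw [PMF.expect_map]
  have : ((fun xs : Fin (T + 1) → X => ∑ t, val (f t) (xs t)) ∘
      fun x => (Fin.snoc xs x : Fin (T + 1) → X)) =
      fun x => ∑ t, val (Fin.init f t) (xs t) + val (f (Fin.last T)) x := by
    funext x
    simp [Fin.sum_univ_castSucc, Fin.init]
  rw [this, PMF.expect_add, PMF.expect_const]

/-- The fractional points depend on the rewards alone, not on earlier rounded decisions, so the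
average over histories is that of a constant. -/
theorem raoco_expectedReward (P : OCOPolicy n) (Ξ : Vec n → PMF (IndepSets M))
    (val : WTP.{u} n → IndepSets M → ℝ) (f : ℕ → WTP.{u} n) (T : ℕ) :
    (raoco M P Ξ).expectedReward val T (fun t : Fin T => f t) =
      ∑ t ∈ Finset.range T, (Ξ (P.play (fun s => (f s).relax) t)).expect (val (f t)) := by
  induction T with
  | zero => simp [OnlinePolicy.expectedReward]
  | succ T ih =>
    rw [OnlinePolicy.expectedReward_succ, Finset.sum_range_succ, ← ih]
    congr 1
    exact PMF.expect_const ((raoco M P Ξ).law T fun t : Fin T => f t)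
      ((Ξ (P.play (fun s => (f s).relax) T)).expect (val (f T)))

theorem raoco_alphaRegret_sequence_le {𝓕 : Set (WTP.{u} n)}
    {Ξ : Vec n → PMF (IndepSets M)} (hΞ : IsSwapRounding M Ξ ∨ IsPipageRounding M Ξ)
    {G : (Vec n → ℝ) → Vec n → Vec n}
    (hG : IsSupergradientOracle (WTP.relax '' 𝓕) (fracSet M) G) {P : OCOPolicy n}
    {f : ℕ → WTP.{u} n} (hf : ∀ t, f t ∈ 𝓕) {T : ℕ} {B : ℝ} (hB0 : 0 ≤ B)
    (hmem : ∀ t, P.play (fun s => (f s).relax) t ∈ fracSet M)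
    (hB : ∀ u ∈ fracSet M, ∑ t ∈ Finset.range T,
      inner ℝ (G (f t).relax (P.play (fun s => (f s).relax) t))
        (u - P.play (fun s => (f s).relax) t) ≤ B) :
    (⨆ x : IndepSets M, wtpRatio 𝓕 * ∑ t : Fin T, (f t).eval x.1) -
      (raoco M P Ξ).expectedReward (fun f x => f.eval x.1) T (fun t : Fin T => f t) ≤ B := by
  have : Nonempty (IndepSets M) := ⟨⟨∅, by simp⟩⟩
  set y := P.play fun s => (f s).relax with hy
  obtain ⟨hα0, hα1⟩ := wtpRatio_mem_Icc 𝓕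
  rw [sub_le_iff_le_add, raoco_expectedReward]
  refine ciSup_le fun x => ?_
  have hsum : ∑ t : Fin T, (f t).eval x.1 = ∑ t ∈ Finset.range T, (f t).eval x.1 :=
    Fin.sum_univ_eq_sum_range (fun t => (f t).eval x.1) T
  have h1 : ∑ t ∈ Finset.range T, wtpRatio 𝓕 * (f t).relax (y t) ≤
      ∑ t ∈ Finset.range T, (Ξ (y t)).expect fun A => (f t).eval A.1 :=
    Finset.sum_le_sum fun t _ => wtpRatio_mul_relax_le hΞ (hmem t) (hf t)
  have h2 : ∑ t ∈ Finset.range T, ((f t).eval x.1 - (f t).relax (y t)) ≤ B := by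
    refine le_trans (Finset.sum_le_sum fun t _ => ?_) (hB _ (charVec_mem_fracSet x))
    have := hG _ ⟨f t, hf t, rfl⟩ _ (hmem t) (charVec x.1)
    rw [← neg_sub, inner_neg_right] at this
    unfold WTP.eval
    linarith
  rw [Finset.sum_sub_distrib] at h2
  rw [← Finset.mul_sum] at h1
  have h3 := mul_le_mul_of_nonneg_left h2 hα0
  have h4 := mul_le_of_le_one_left hB0 hα1
  rw [hsum]
  linarith

end AlphaRegret

theorem theorem3 {n : ℕ} (M : Matroid (Fin n)) (L : ℝ≥0)
    (A : OCOMethod n) (hA : A.Admissible (fracSet M))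
    (a b : ℝ) (ha : 0 < a) (hab : a ≤ b) :
    ∃ K : ℝ, ∀ 𝓕 : Set (WTP.{u} n),
      (∀ f ∈ 𝓕, LipschitzOnWith L f.relax (fracSet M)) →
      ∀ Ξ : Vec n → PMF (IndepSets M), (IsSwapRounding M Ξ ∨ IsPipageRounding M Ξ) →
      ∀ G : (Vec n → ℝ) → Vec n → Vec n,
        IsSupergradientOracle (WTP.relax '' 𝓕) (fracSet M) G →
      ∀ T : ℕ, 1 ≤ T →
      ∀ η : ℝ, a / Real.sqrt T ≤ η → η ≤ b / Real.sqrt T →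
      ∀ P : OCOPolicy n, A.IsPolicy (fracSet M) (WTP.relax '' 𝓕) G η P →
        (raoco M P Ξ).alphaRegret (fun f x => f.eval x.1) (wtpRatio 𝓕) 𝓕 T
          ≤ ((K * Real.sqrt T : ℝ) : EReal) := by
  obtain ⟨K, hK, hreg⟩ := A.regret convex_fracSet isCompact_fracSet hA
    (C := L * n) (by positivity)
  -- After division by `η`, the two terms are `K / η ≤ (K / a) √T` and `T η K ≤ b K √T`.
  refine ⟨K / a + b * K, fun 𝓕 hL Ξ hΞ G hG T hT η hη₁ hη₂ P hP => ?_⟩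
  have hsq : 0 < Real.sqrt T := Real.sqrt_pos.2 (by exact_mod_cast hT)
  have hη : 0 < η := (div_pos ha hsq).trans_le hη₁
  refine iSup₂_le fun f hf => ?_
  -- The regret bounds are stated for infinite sequences; the finite one is continued by its first
  -- reward, which exists as `1 ≤ T`.
  obtain ⟨F, hF, rfl⟩ : ∃ F : ℕ → WTP.{u} n, (∀ t, F t ∈ 𝓕) ∧ f = fun t : Fin T => F t := by
    refine ⟨fun t => if h : t < T then f ⟨t, h⟩ else f ⟨0, hT⟩, fun t => ?_, ?_⟩
    · dsimp only
      split_ifs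
      · exact hf _
      · exact hf _
    · funext t
      simp
  obtain ⟨hmem, hbd⟩ := hreg _ G η P hη.le
    (by
      rintro _ ⟨f, hf, rfl⟩ y hy u hu v hv
      exact (hG _ ⟨f, hf, rfl⟩ y hy).inner_sub_le (hL f hf) hu hv)
    hP (fun t => (F t).relax) fun t => ⟨F t, hF t, rfl⟩
  refine EReal.coe_le_coe_iff.2 (raoco_alphaRegret_sequence_le hΞ hG hF ?_ hmem fun u hu => ?_)
  · have : 0 ≤ b := ha.le.trans hab
    positivity
  · refine le_of_mul_le_mul_left ((hbd T u hu).trans ?_) hη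
    have hT' : (T : ℝ) = Real.sqrt T * Real.sqrt T := (Real.mul_self_sqrt (Nat.cast_nonneg T)).symm
    have h1 : a ≤ η * Real.sqrt T := (div_le_iff₀ hsq).1 hη₁
    have h2 : η * Real.sqrt T ≤ b := (le_div_iff₀ hsq).1 hη₂
    have h3 : K ≤ η * (K / a * Real.sqrt T) := by
      calc K = K / a * a := by field_simp
        _ ≤ K / a * (η * Real.sqrt T) := mul_le_mul_of_nonneg_left h1 (div_nonneg hK ha.le)
        _ = η * (K / a * Real.sqrt T) := by ring
    have h4 : T * η ^ 2 * K ≤ η * (b * K * Real.sqrt T) := by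
      calc T * η ^ 2 * K = (η * Real.sqrt T) * (η * Real.sqrt T * K) := by
            rw [hT', Real.sqrt_mul_self hsq.le]; ring
        _ ≤ b * (η * Real.sqrt T * K) := mul_le_mul_of_nonneg_right h2 (by positivity)
        _ = η * (b * K * Real.sqrt T) := by ring
    linarith
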